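/- **Setting.** Let $G=(V,E)$ be a finite unweighted graph (directed or undirected) with $n=|V|\ge 2$ nodes. For $s\ne t$ let $\Pi_{st}$ be the set of shortest paths from $s$ to $t$, $\sigma_{st}=|\Pi_{st}|$, and $\sigma_{st}(v)$ the number of those having $v$ as an internal node. The betweenness centrality is $b(v)=\frac1{n(n-1)}\sum_{(s,t):\,s\ne t,\ s\neq v\neq t}\frac{\sigma_{st}(v)}{\sigma_{st}}$ (with $0/0=0$). Fix an order $v_1,\dots,v_n$ of the nodes with $b(v_i)\ge b(v_{i+1})$, an integer $1\le k\le n$, and put $TOP(k)=\{(v_i,b(v_i)):i\le k\}$. For $\eta\in(0,1)$, a set $T$ of pairs $(v,\tilde b(v))$ with $v\in V$ and $\tilde b(v)\in[0,1]$ (one pair per node at most) is an *$\eta$-relative approximation* of $TOP(k)$ if (i) each of $v_1,\dots,v_k$ occurs in $T$; (ii) $|b(v)-\tilde b(v)|\le\eta\, b(v)$ for all $(v,\tilde b(v))\in T$; (iii) $b(v)\ge b(v_k)\left(\frac{1-\eta}{1+\eta}\right)^2$ for every node $v\notin\{v_1,\dots,v_k\}$ occurring in $T$. **Sampling.** Fix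 $\alpha\ge1$. A random *bag* $\tau$ is drawn as follows: draw an ordered pair $(s,t)$ of different nodes uniformly at random, then draw $\lceil\alpha\sigma_{st}\rceil$ elements of $\Pi_{st}$ independently and uniformly. Let $f_v(\tau)$ be the fraction of the paths of $\tau$ that have $v$ as an internal node ($0$ if $\tau$ is empty). **Algorithm SILVAN-TopK**, with input $G$, integers $c,k\ge1$ with $k\le n$, and $\eta,\delta\in(0,1)$. *Phase 1.* Draw independent bags one at a time until at least $k$ different nodes have been observed (as internal nodes of a path of the bag) in at least $r$ bags, where $r\ge1$ is a constant; let $\mathcal S'$ be the sample obtained. Using any rule that depends only on $\mathcal S'$, partition $\{f_v:v\in V\}$ into classes $\mathcal F_1,\dots,\mathcal F_t$ (empty classes allowed). Using any rule that depends only on $\mathcal S'$, choose a nondecreasing schedule $0=m_0$, $1\le m_1\le m_2\le\cdots$. *Phase 2.* For $i=1,2,\dots$, let $\mathcal S_i=(\tau_1,\dots,\tau_{m_i})$ be obtained from $\mathcal S_{i-1}$ by adding $m_i-m_{i-1}$ fresh independent bags, and add $m_i-m_{i-1}$ fresh columns of $c$ independent uniform signs to a matrix, which is then $\boldsymbol\sigma\in\{-1,1\}^{c\times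 m_i}$. With $m=m_i$ and $L=\ln\frac{5\,t\,2^i}{\delta}$, compute $\tilde b(v)=\frac1m\sum_{l\le m} f_v(\tau_l)$ and, for each class $\mathcal F_j$ (suprema over an empty class being $0$), $$\hat R_j=\frac1c\sum_{x=1}^c\sup_{f\in\mathcal F_j}\frac1m\sum_{l=1}^m\boldsymbol\sigma_{x,l}f(\tau_l),\qquad w_j=\sup_{f\in\mathcal F_j}\frac1m\sum_{l=1}^m f(\tau_l)^2,\qquad \nu_j=w_j+\frac Lm+\sqrt{\Big(\frac Lm\Big)^2+\frac{2w_jL}m},$$ $$\tilde{\mathsf R}_j=\hat R_j+\sqrt{\frac{4w_jL}{cm}},\qquad \mathsf R_j=\tilde{\mathsf R}_j+\frac Lm+\sqrt{\Big(\frac Lm\Big)^2+\frac{2L\tilde{\mathsf R}_j}m},\qquad \varepsilon_j=2\mathsf R_j+\sqrt{\frac{2L(\nu_j+4\mathsf R_j)}m}+\frac L{3m}$$ (the square root of a negative number, should one occur, is read as $0$). For $f_v\in\mathcal F_j$ put $\ell(v)=\tilde b(v)-\varepsilon_j$ and $u(v)=\tilde b(v)+\varepsilon_j$, and let $\widetilde{TOP}(k)=\{(v,\tilde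 b(v)):u(v)\ge\ell_k\}$, where $\ell_k$ is the $k$-th largest of the values $\ell(v)$, $v\in V$. If $\frac{\tilde b(v)}{1+\eta}\le\ell(v)$ and $u(v)\le\frac{\tilde b(v)}{1-\eta}$ for all $(v,\tilde b(v))\in\widetilde{TOP}(k)$, stop and output $\widetilde{TOP}(k)$; otherwise go on to iteration $i+1$. **Proposition.** With probability at least $1-\delta$, any output of SILVAN-TopK is an $\eta$-relative approximation of $TOP(k)$; that is, the probability that the algorithm halts with an output that is not an $\eta$-relative approximation of $TOP(k)$ is at most $\delta$. If moreover $b(v_k)>0$ and every schedule chosen satisfies $i/m_i\to0$ as $i\to\infty$ (as geometric schedules do), then the algorithm halts almost surely, and hence with probability at least $1-\delta$ it halts and its output is an $\eta$-relative approximation of $TOP(k)$. -/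

import Mathlib

open MeasureTheory Filter Topology

noncomputable section

namespace Silvan

/-! ### Shortest paths and betweenness centrality

Graphs are finite and unweighted, directed or undirected: an undirected graph is a `Digraph` with
symmetric adjacency. -/

/-- `p` is the vertex sequence of a walk from `s` to `t` in `G`. -/
def IsWalk {V : Type*} (G : Digraph V) (s t : V) (p : List V) : Prop :=
  p.head? = some s ∧ p.getLast? = some t ∧ p.IsChain G.Adj

/-- `p` is a shortest path from `s` to `t` in `G`: a walk with the least number of vertices. -/
def IsShortestPath {V : Type*} (G : Digraph V) (s t : V) (p : List V) : Prop :=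
  IsWalk G s t p ∧ ∀ q, IsWalk G s t q → p.length ≤ q.length

/-- The set `Π_st` of shortest paths from `s` to `t` (empty if `t` is not reachable from `s`). -/
abbrev ShortestPath {V : Type*} (G : Digraph V) (s t : V) : Type _ :=
  {p : List V // IsShortestPath G s t p}

instance {V : Type*} [Fintype V] (G : Digraph V) (s t : V) : Finite (ShortestPath G s t) := by
  by_cases h : ∃ p, IsShortestPath G s t p
  · obtain ⟨p, hp⟩ := h
    refine Set.Finite.subset (List.finite_length_eq V p.length) ?_
    intro q hq
    exact le_antisymm (hq.2 p hp.1) (hp.2 q hq.1)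
  · exact @Finite.of_subsingleton _ ⟨fun a => (h ⟨a.1, a.2⟩).elim⟩

instance {V : Type*} [Fintype V] (G : Digraph V) (s t : V) : Fintype (ShortestPath G s t) :=
  Fintype.ofFinite _

/-- `v` is an internal node of a path `p` from `s` to `t`. -/
def IsInternal {V : Type*} (s t v : V) (p : List V) : Prop :=
  v ∈ p ∧ v ≠ s ∧ v ≠ t

/-- The number `σ_st` of shortest paths from `s` to `t`. -/
def numPaths {V : Type*} [Fintype V] (G : Digraph V) (s t : V) : ℕ :=
  Fintype.card (ShortestPath G s t)

/-- The number `σ_st(v)` of shortest paths from `s` to `t` that pass through `v`. -/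
def numPathsThrough {V : Type*} [Fintype V] (G : Digraph V) (s t v : V) : ℕ :=
  Nat.card {p : ShortestPath G s t // IsInternal s t v p.1}

open Classical in
/-- Normalized betweenness centrality of `v`; a pair `(s, t)` without any path from `s` to `t`
contributes `0 / 0 = 0`. -/
def betweenness {V : Type*} [Fintype V] (G : Digraph V) (v : V) : ℝ :=
  1 / ((Fintype.card V : ℝ) * ((Fintype.card V : ℝ) - 1)) *
    ∑ e : V × V with e.1 ≠ e.2 ∧ e.1 ≠ v ∧ e.2 ≠ v,
      (numPathsThrough G e.1 e.2 v : ℝ) / (numPaths G e.1 e.2 : ℝ)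

/-! ### Random bags of shortest paths -/

/-- Ordered pairs of different nodes. -/
abbrev NodePair (V : Type*) : Type _ := {e : V × V // e.1 ≠ e.2}

/-- The number `⌈α σ_st⌉` of shortest paths in a bag. -/
def bagSize {V : Type*} [Fintype V] (G : Digraph V) (α : ℝ) (e : NodePair V) : ℕ :=
  ⌈α * (numPaths G e.1.1 e.1.2 : ℝ)⌉₊

/-- A bag: a pair `(s, t)` with `s ≠ t`, together with `⌈α σ_st⌉` shortest paths from `s` to `t`
(repetitions allowed). -/
def Bag {V : Type*} [Fintype V] (G : Digraph V) (α : ℝ) : Type _ :=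
  Σ e : NodePair V, Fin (bagSize G α e) → ShortestPath G e.1.1 e.1.2

instance {V : Type*} [Fintype V] (G : Digraph V) (α : ℝ) : MeasurableSpace (Bag G α) := ⊤

instance {V : Type*} [Nontrivial V] : Nonempty (NodePair V) :=
  let ⟨a, b, h⟩ := exists_pair_ne V
  ⟨⟨(a, b), h⟩⟩

instance {V : Type*} [Fintype V] : Fintype (NodePair V) := Fintype.ofFinite _

instance {V : Type*} [Fintype V] (G : Digraph V) (α : ℝ) (e : NodePair V) :
    Nonempty (Fin (bagSize G α e) → ShortestPath G e.1.1 e.1.2) := by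
  by_cases h : Nonempty (ShortestPath G e.1.1 e.1.2)
  · exact ⟨fun _ => h.some⟩
  · have h0 : bagSize G α e = 0 := by
      have : IsEmpty (ShortestPath G e.1.1 e.1.2) := not_nonempty_iff.mp h
      simp [bagSize, numPaths]
    rw [h0]
    exact ⟨Fin.elim0⟩

open Classical in
/-- The sampling procedure: draw a uniform ordered pair of different nodes `(s, t)`, then draw
`⌈α σ_st⌉` shortest paths from `s` to `t` independently and uniformly at random (that is, draw a
uniform element of `Π_st ^ ⌈α σ_st⌉`). -/
def bagPMF {V : Type*} [Fintype V] [Nontrivial V] (G : Digraph V) (α : ℝ) : PMF (Bag G α) :=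
  (PMF.uniformOfFintype (NodePair V)).bind fun e =>
    (PMF.uniformOfFintype (Fin (bagSize G α e) → ShortestPath G e.1.1 e.1.2)).map
      (Sigma.mk (β := fun e : NodePair V =>
        Fin (bagSize G α e) → ShortestPath G e.1.1 e.1.2) e)

open Classical in
/-- `f_v(τ)`: the fraction of the paths of the bag `τ` that have `v` as an internal node
(`0` for the empty bag). -/
def bagFrac {V : Type*} [Fintype V] {G : Digraph V} {α : ℝ} (v : V) (τ : Bag G α) : ℝ :=
  (∑ x, if IsInternal τ.1.1.1 τ.1.1.2 v (τ.2 x).1 then (1 : ℝ) else 0) / (bagSize G α τ.1 : ℝ)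

/-- `v` is observed in the bag `τ`: it is internal to some path of `τ`. -/
def Observed {V : Type*} [Fintype V] {G : Digraph V} {α : ℝ} (v : V) (τ : Bag G α) : Prop :=
  ∃ x, IsInternal τ.1.1.1 τ.1.1.2 v (τ.2 x).1

/-! ### Empirical quantities

Here `S 0, …, S (m - 1)` is the sample, `σ i x` (`true` for `1`, `false` for `-1`) is the entry in
row `x` and column `i` of the sign matrix, and the class of index `j` of the partition of the
functions `f_v` given by `lab : V → Fin t` is `{f_v : lab v = j}`. -/

/-- The sign encoded by a Boolean. -/
def sgn (b : Bool) : ℝ := if b then 1 else -1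

/-- The estimate of the betweenness of `v`: the average of `f_v` over the sample. -/
def estimate {V : Type*} [Fintype V] {G : Digraph V} {α : ℝ} (S : ℕ → Bag G α) (m : ℕ) (v : V) :
    ℝ :=
  1 / (m : ℝ) * ∑ i ∈ Finset.range m, bagFrac v (S i)

/-- The Monte Carlo empirical Rademacher average of class `j`, with `c` rows of signs. -/
def mcera {V : Type*} [Fintype V] {G : Digraph V} {α : ℝ} {c t : ℕ} (S : ℕ → Bag G α)
    (σ : ℕ → Fin c → Bool) (m : ℕ) (lab : V → Fin t) (j : Fin t) : ℝ :=
  1 / (c : ℝ) * ∑ x : Fin c, ⨆ v : {v : V // lab v = j},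
    1 / (m : ℝ) * ∑ i ∈ Finset.range m, sgn (σ i x) * bagFrac v.1 (S i)

/-- The empirical wimpy variance of class `j`. -/
def wimpyVar {V : Type*} [Fintype V] {G : Digraph V} {α : ℝ} {t : ℕ} (S : ℕ → Bag G α)
    (m : ℕ) (lab : V → Fin t) (j : Fin t) : ℝ :=
  ⨆ v : {v : V // lab v = j}, 1 / (m : ℝ) * ∑ i ∈ Finset.range m, bagFrac v.1 (S i) ^ 2

/-- The upper bound on the variances of a class with empirical wimpy variance `w`, for a sample of
size `m`; `L` is the logarithmic confidence term. -/
def varBound (w L : ℝ) (m : ℕ) : ℝ :=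
  w + L / m + √((L / m) ^ 2 + 2 * w * L / m)

/-- The bound on the supremum deviation of a class with Monte Carlo Rademacher average `rad`,
empirical wimpy variance `w` and variance bound `ν`. -/
def epsBound (rad w ν L : ℝ) (c m : ℕ) : ℝ :=
  let R' := rad + √(4 * w * L / (c * m))
  let R := R' + L / m + √((L / m) ^ 2 + 2 * L * R' / m)
  2 * R + √(2 * L * (ν + 4 * R) / m) + L / (3 * m)

/-- The bound on the supremum deviation of class `j` that is computed at iteration `i`, with
confidence `δ / 2 ^ i`. -/
def epsClass {V : Type*} [Fintype V] {G : Digraph V} {α : ℝ} {c t : ℕ} (δ : ℝ) (S : ℕ → Bag G α)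
    (σ : ℕ → Fin c → Bool) (m : ℕ) (lab : V → Fin t) (i : ℕ) (j : Fin t) : ℝ :=
  let L := Real.log (5 * t * 2 ^ i / δ)
  let w := wimpyVar S m lab j
  epsBound (mcera S σ m lab j) w (varBound w L m) L c m

/-- The `k`-th largest value of `g` (`1 ≤ k ≤ |V|`), counted with multiplicity. -/
def kthLargest {V : Type*} [Fintype V] (g : V → ℝ) (k : ℕ) : ℝ :=
  ((Finset.univ.val.map g).sort (· ≥ ·)).getD (k - 1) 0

/-! ### The algorithm -/

/-- The parameters of the algorithm.
* `c`: number of Monte Carlo rows; `k`: number of top nodes; `η`, `δ`: accuracy and confidence;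
* `r`: the first phase stops when `k` nodes have been observed at least `r` times;
* `peel`: the rule that partitions the functions `f_v` into `t` classes, given the first sample;
* `sched`: the sampling schedule `m_1 ≤ m_2 ≤ …`, given the first sample. -/
structure Params {V : Type*} [Fintype V] (G : Digraph V) (α : ℝ) where
  c : ℕ
  k : ℕ
  η : ℝ
  δ : ℝ
  r : ℕ
  peel : List (Bag G α) → Σ t : ℕ, (V → Fin t)
  sched : List (Bag G α) → ℕ → ℕ

/-- The random input of the algorithm: the bags of the first phase, the bags of the second phase,
and the columns of the sign matrix. -/
abbrev Sample {V : Type*} [Fintype V] (G : Digraph V) (α : ℝ) (c : ℕ) : Type _ :=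
  (ℕ → Bag G α) × (ℕ → Bag G α) × (ℕ → Fin c → Bool)

/-- The law of the random input: all bags and all signs are independent, the bags follow the
sampling procedure and the signs are uniform. -/
def sampleLaw {V : Type*} [Fintype V] [Nontrivial V] (G : Digraph V) (α : ℝ) (c : ℕ) :
    Measure (Sample G α c) :=
  (Measure.infinitePi fun _ : ℕ => (bagPMF G α).toMeasure).prod
    ((Measure.infinitePi fun _ : ℕ => (bagPMF G α).toMeasure).prod
      (Measure.infinitePi fun _ : ℕ => (PMF.uniformOfFintype (Fin c → Bool)).toMeasure))

instance {V : Type*} [Fintype V] [Nontrivial V] (G : Digraph V) (α : ℝ) (c : ℕ) :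
    IsProbabilityMeasure (sampleLaw G α c) := by
  unfold sampleLaw; infer_instance

/-- The list of the first `n` terms of a sequence of bags. -/
def firstBags {V : Type*} [Fintype V] {G : Digraph V} {α : ℝ} (S : ℕ → Bag G α) (n : ℕ) :
    List (Bag G α) :=
  (List.range n).map S

open Classical in
/-- Stopping condition of the first phase: at least `k` nodes have been observed in at least `r`
bags. -/
def StopFirst {V : Type*} [Fintype V] {G : Digraph V} {α : ℝ} (P : Params G α)
    (S' : List (Bag G α)) : Prop :=
  P.k ≤ (Finset.univ.filter fun v : V => P.r ≤ S'.countP (fun τ => Observed v τ)).card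

section Iteration

variable {V : Type*} [Fintype V] {G : Digraph V} {α : ℝ} (P : Params G α) (S' : List (Bag G α))
  (S : ℕ → Bag G α) (σ : ℕ → Fin P.c → Bool) (i : ℕ) (v : V)

/-- The estimate of the betweenness of `v` at iteration `i`. -/
def bTilde : ℝ := estimate S (P.sched S' i) v

/-- The half-width of the confidence interval of `v` at iteration `i`. -/
def width : ℝ :=
  epsClass P.δ S σ (P.sched S' i) (P.peel S').2 i ((P.peel S').2 v)

/-- The lower end of the confidence interval of `v` at iteration `i`. -/
def lower : ℝ := bTilde P S' S i v - width P S' S σ i v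

/-- The upper end of the confidence interval of `v` at iteration `i`. -/
def upper : ℝ := bTilde P S' S i v + width P S' S σ i v

/-- The nodes whose upper end is at least the `k`-th largest lower end, at iteration `i`. -/
def topNodes : Set V :=
  {v | kthLargest (lower P S' S σ i) P.k ≤ upper P S' S σ i v}

/-- The candidate output at iteration `i`. -/
def topTilde : Set (V × ℝ) :=
  (fun v => (v, bTilde P S' S i v)) '' topNodes P S' S σ i

/-- Stopping condition of the second phase. -/
def StopTopk : Prop :=
  ∀ v ∈ topNodes P S' S σ i,
    bTilde P S' S i v / (1 + P.η) ≤ lower P S' S σ i v ∧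
      upper P S' S σ i v ≤ bTilde P S' S i v / (1 - P.η)

end Iteration

open Classical in
/-- The output of the algorithm on a given random input, `none` if one of its two loops runs
forever. The first phase draws bags until `StopFirst` holds. The second phase runs the iterations
`i = 1, 2, …` until `StopTopk` holds. -/
def output {V : Type*} [Fintype V] {G : Digraph V} {α : ℝ} (P : Params G α)
    (ω : Sample G α P.c) : Option (Set (V × ℝ)) :=
  if h₁ : ∃ n, StopFirst P (firstBags ω.1 n) then
    let S' := firstBags ω.1 (Nat.find h₁)
    if h₂ : ∃ i, 1 ≤ i ∧ StopTopk P S' ω.2.1 ω.2.2 i then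
      some (topTilde P S' ω.2.1 ω.2.2 (Nat.find h₂))
    else none
  else none

/-! ### Relative approximations of the top `k` nodes -/

/-- `T` is an `η`-relative approximation of `TOP(k) = {(v_i, b(v_i)) : i ≤ k}`, where
`v_1, …, v_n` is `v 0, …, v (n - 1)`. -/
structure IsRelativeApprox {V : Type*} [Fintype V] (b : V → ℝ) (v : Fin (Fintype.card V) ≃ V)
    (k : ℕ) (hk : 1 ≤ k) (hkn : k ≤ Fintype.card V) (η : ℝ) (T : Set (V × ℝ)) : Prop where
  /-- One estimate per node. -/
  functional : ∀ p ∈ T, ∀ q ∈ T, p.1 = q.1 → p = q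
  mem_Icc : ∀ p ∈ T, p.2 ∈ Set.Icc (0 : ℝ) 1
  top_subset : ∀ i : Fin (Fintype.card V), i.1 < k → ∃ x, (v i, x) ∈ T
  estimates : ∀ p ∈ T, |b p.1 - p.2| ≤ η * b p.1
  others : ∀ p ∈ T, (∀ i : Fin (Fintype.card V), i.1 < k → p.1 ≠ v i) →
    b (v ⟨k - 1, by omega⟩) * ((1 - η) / (1 + η)) ^ 2 ≤ b p.1

end Silvan

end

noncomputable section

namespace Silvan

/-! ### Expectations under product weights -/

/-! Everything rests on one event: every interval computed in the second phase, for every iteration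
and every node, contains the true betweenness. On this event the claim is deterministic
(`isRelativeApprox_topTilde`). The nodes `v_1, …, v_k` are selected because `ℓ_k ≤ b(v_k)`. The
stopping rule forces `ℓ(v) / u(v) ≥ (1 - η) / (1 + η)` on selected nodes, and using this ratio twice
gives the square in the last clause.

The probability of a miss is controlled class by class (`measure_epsClass_lt`). Five inequalities,
each failing with probability at most `exp (-L) = δ / (5 t 2^i)`, imply the bound: the Monte Carlo
average against the empirical Rademacher average (`mcera_tail`), the latter against its expectation
(`era_tail`), the empirical against the true wimpy variance (`wimpy_tail`), and Bousquet's
inequality with symmetrization in both directions (`deviation_tail`). Summing over classes and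
iterations gives `δ`. The partition and the schedule depend on the first phase only, so they are
constants once that phase is conditioned on; this is Fubini in `measure_badEvent_le`. The functions
`f_v` have mean `b(v)` by `sum_weight_mul_bagFrac`.

The concentration inequalities have a common mechanism. A supremum over a finite class is a
functional on `ℝ^ι` whose subgradients are probability vectors (`HasSubgradients`), hence convex,
monotone and compatible with adding constants. This property survives averaging over sample points
and signs, so each exponential inequality follows by induction on the sample size from an inequality
for a single coordinate. The one-coordinate inequalities are `bennett_step`, `symmetrization_step`,
`lower_tail_step` and `sign_lower_tail_step`. Chernoff's method then yields the tails; only the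
wimpy variance needs no supremum argument, a single maximizing function being enough.

Termination is a law of large numbers. Almost surely the estimates tend to `b` and the signed
averages to `0`. Since `i / m_i → 0`, also `L / m → 0`, so all widths tend to `0`, while estimates
of selected nodes stay bounded away from `0` because `b(v_k) > 0`. -/

/-- The expectation of `F` under the `m`-fold product of the weights `p`. -/
def pexp {Ω : Type*} [Fintype Ω] (p : Ω → ℝ) (m : ℕ) (F : (Fin m → Ω) → ℝ) : ℝ :=
  ∑ x, (∏ l, p (x l)) * F x

section Pexp

variable {Ω : Type*} [Fintype Ω] {p : Ω → ℝ} {m : ℕ} {F F' : (Fin m → Ω) → ℝ}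

theorem pexp_zero (p : Ω → ℝ) (F : (Fin 0 → Ω) → ℝ) : pexp p 0 F = F Fin.elim0 := by
  have : (default : Fin 0 → Ω) = Fin.elim0 := Subsingleton.elim _ _
  simp [pexp, this]

theorem pexp_succ (p : Ω → ℝ) (m : ℕ) (F : (Fin (m + 1) → Ω) → ℝ) :
    pexp p (m + 1) F = ∑ a, p a * pexp p m fun x => F (Fin.cons a x) := by
  unfold pexp
  rw [← (Fin.consEquiv fun _ => Ω).sum_comp, Fintype.sum_prod_type]
  refine Finset.sum_congr rfl fun a _ => ?_
  rw [Finset.mul_sum]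
  refine Finset.sum_congr rfl fun x _ => ?_
  simp [Fin.consEquiv, Fin.prod_univ_succ, mul_assoc]

theorem prod_mem_stdSimplex (hp : p ∈ stdSimplex ℝ Ω) (m : ℕ) :
    (fun x : Fin m → Ω => ∏ l, p (x l)) ∈ stdSimplex ℝ (Fin m → Ω) := by
  classical
  refine ⟨fun x => Finset.prod_nonneg fun l _ => hp.1 _, ?_⟩
  have := Finset.prod_univ_sum (fun _ : Fin m => (Finset.univ : Finset Ω)) fun _ a => p a
  simpa [hp.2] using this.symm

theorem pexp_mono (hp : p ∈ stdSimplex ℝ Ω) (h : ∀ x, F x ≤ F' x) : pexp p m F ≤ pexp p m F' :=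
  Finset.sum_le_sum fun x _ => mul_le_mul_of_nonneg_left (h x) ((prod_mem_stdSimplex hp m).1 x)

theorem pexp_const (hp : p ∈ stdSimplex ℝ Ω) (r : ℝ) : pexp p m (fun _ => r) = r := by
  unfold pexp
  rw [← Finset.sum_mul, (prod_mem_stdSimplex hp m).2, one_mul]

theorem pexp_nonneg (hp : p ∈ stdSimplex ℝ Ω) (h : ∀ x, 0 ≤ F x) : 0 ≤ pexp p m F :=
  Finset.sum_nonneg fun x _ => mul_nonneg ((prod_mem_stdSimplex hp m).1 x) (h x)

theorem pexp_const_mul (r : ℝ) (F : (Fin m → Ω) → ℝ) :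
    pexp p m (fun x => r * F x) = r * pexp p m F := by
  unfold pexp
  rw [Finset.mul_sum]
  exact Finset.sum_congr rfl fun x _ => by ring

theorem pexp_add (F F' : (Fin m → Ω) → ℝ) :
    pexp p m (fun x => F x + F' x) = pexp p m F + pexp p m F' := by
  unfold pexp
  rw [← Finset.sum_add_distrib]
  exact Finset.sum_congr rfl fun x _ => by ring

theorem pexp_sum {κ : Type*} (s : Finset κ) (F : κ → (Fin m → Ω) → ℝ) :
    pexp p m (fun x => ∑ k ∈ s, F k x) = ∑ k ∈ s, pexp p m (F k) := by
  unfold pexp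
  simp_rw [Finset.mul_sum]
  exact Finset.sum_comm

theorem pexp_prod (p : Ω → ℝ) (m : ℕ) (g : Ω → ℝ) :
    pexp p m (fun x => ∏ l, g (x l)) = (∑ a, p a * g a) ^ m := by
  induction m with
  | zero => simp [pexp_zero]
  | succ m ih =>
    rw [pexp_succ, pow_succ', Finset.sum_mul]
    refine Finset.sum_congr rfl fun a _ => ?_
    simp only [Fin.prod_univ_succ, Fin.cons_zero, Fin.cons_succ]
    rw [pexp_const_mul, ih, mul_assoc]

end Pexp

/-- The weights of a uniform sign. -/
def signWeight (_ : Bool) : ℝ := 1 / 2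

theorem signWeight_mem : signWeight ∈ stdSimplex ℝ Bool :=
  ⟨fun _ => by norm_num [signWeight], by simp [signWeight]⟩

theorem rad_succ (m : ℕ) (F : (Fin (m + 1) → Bool) → ℝ) :
    pexp signWeight (m + 1) F =
      pexp signWeight m fun ε => 1 / 2 * F (Fin.cons true ε) + 1 / 2 * F (Fin.cons false ε) := by
  rw [pexp_succ, pexp_add, pexp_const_mul, pexp_const_mul]
  simp [signWeight]

theorem rad_comp_not (m : ℕ) (F : (Fin m → Bool) → ℝ) :
    pexp signWeight m (fun ε => F fun l => !ε l) = pexp signWeight m F := by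
  unfold pexp
  rw [← (Equiv.piCongrRight fun _ : Fin m => Equiv.boolNot).sum_comp]
  refine Finset.sum_congr rfl fun ε _ => ?_
  simp [signWeight]

theorem sgn_not (b : Bool) : sgn (!b) = -sgn b := by cases b <;> simp [sgn]

/-! ### Functionals with subgradients -/

/-- `H` has, at every point, a subgradient that is a probability vector. -/
def HasSubgradients {ι : Type*} [Fintype ι] (H : (ι → ℝ) → ℝ) : Prop :=
  ∀ c, ∃ w ∈ stdSimplex ℝ ι, ∀ d, H c + ∑ a, w a * d a ≤ H (c + d)

namespace HasSubgradients

variable {ι : Type*} [Fintype ι] {H : (ι → ℝ) → ℝ}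

theorem iSup [Nonempty ι] : HasSubgradients fun c : ι → ℝ => ⨆ a, c a := by
  classical
  intro c
  obtain ⟨a, ha⟩ := exists_eq_ciSup_of_finite (f := c)
  -- The point mass at a maximizer is a subgradient.
  refine ⟨Pi.single a 1, single_mem_stdSimplex ℝ a, fun d => ?_⟩
  have h : ∑ b, (Pi.single a 1 : ι → ℝ) b * d b = d a := by
    simp [Pi.single_apply]
  rw [h]
  simp only [← ha]
  exact le_ciSup (f := c + d) (Set.finite_range _).bddAbove a

theorem shift (hH : HasSubgradients H) (e : ι → ℝ) : HasSubgradients fun c => H (c + e) := by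
  intro c
  obtain ⟨w, hw, h⟩ := hH (c + e)
  exact ⟨w, hw, fun d => by simpa [add_right_comm] using h d⟩

theorem sum {κ : Type*} [Fintype κ] {q : κ → ℝ} (hq : q ∈ stdSimplex ℝ κ)
    {H : κ → (ι → ℝ) → ℝ} (hH : ∀ k, HasSubgradients (H k)) :
    HasSubgradients fun c => ∑ k, q k * H k c := by
  intro c
  choose w hw h using fun k => hH k c
  refine ⟨fun a => ∑ k, q k * w k a, ⟨fun a => ?_, ?_⟩, fun d => ?_⟩
  · exact Finset.sum_nonneg fun k _ => mul_nonneg (hq.1 k) ((hw k).1 a)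
  · rw [Finset.sum_comm]
    simp_rw [← Finset.mul_sum, (hw _).2, mul_one, hq.2]
  · have : ∑ a, (∑ k, q k * w k a) * d a = ∑ k, q k * ∑ a, w k a * d a := by
      simp_rw [Finset.sum_mul, Finset.mul_sum]
      rw [Finset.sum_comm]
      simp_rw [mul_assoc]
    rw [this, ← Finset.sum_add_distrib]
    refine Finset.sum_le_sum fun k _ => ?_
    rw [← mul_add]
    exact mul_le_mul_of_nonneg_left (h k d) (hq.1 k)

/-- This closure property drives the inductions on the sample size: after the remaining coordinates
are averaged out, the result is again a functional of the same kind, so only one coordinate needs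
work. -/
theorem average {Ω : Type*} [Fintype Ω] {p : Ω → ℝ} (hp : p ∈ stdSimplex ℝ Ω) {m : ℕ}
    {H : (Fin m → Ω) → (ι → ℝ) → ℝ} (hH : ∀ x, HasSubgradients (H x)) :
    HasSubgradients fun c => pexp p m fun x => H x c :=
  sum (prod_mem_stdSimplex hp m) hH

theorem half {H' : (ι → ℝ) → ℝ} (hH : HasSubgradients H) (hH' : HasSubgradients H') :
    HasSubgradients fun c => 1 / 2 * H c + 1 / 2 * H' c := by
  have := sum signWeight_mem (H := fun b => if b then H else H') (by rintro (_ | _) <;> simpa)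
  simpa [signWeight] using this

/-- Use the subgradient at `c + d` in the direction `-d`; its weights are nonnegative and sum to
one. The case `r = 0` is monotonicity. -/
theorem le_add (hH : HasSubgradients H) (c : ι → ℝ) {d : ι → ℝ} {r : ℝ} (hd : ∀ a, d a ≤ r) :
    H (c + d) ≤ H c + r := by
  obtain ⟨w, hw, h⟩ := hH (c + d)
  have h1 := h (-d)
  rw [add_neg_cancel_right] at h1
  have h2 : ∑ a, w a * d a ≤ r := by
    calc ∑ a, w a * d a ≤ ∑ a, w a * r :=
          Finset.sum_le_sum fun a _ => mul_le_mul_of_nonneg_left (hd a) (hw.1 a)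
      _ = r := by rw [← Finset.sum_mul, hw.2, one_mul]
  have h3 : ∑ a, w a * (-d) a = -∑ a, w a * d a := by simp
  linarith

theorem mono (hH : HasSubgradients H) {c c' : ι → ℝ} (h : ∀ a, c a ≤ c' a) : H c ≤ H c' := by
  have := hH.le_add c' (d := c - c') (r := 0) fun a => by simpa using h a
  simpa using this

/-- Convexity: the linear terms of one subgradient, taken at the intermediate point, cancel when the
inequalities towards the two ends are weighted by `t` and `1 - t`. -/
theorem le_mix (hH : HasSubgradients H) (c d : ι → ℝ) {t : ℝ} (h0 : 0 ≤ t) (h1 : t ≤ 1) :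
    H (c + t • d) ≤ t * H (c + d) + (1 - t) * H c := by
  obtain ⟨w, -, h⟩ := hH (c + t • d)
  have e1 := h ((1 - t) • d)
  have e2 := h ((-t) • d)
  have a1 : c + t • d + (1 - t) • d = c + d := by ext a; simp; ring
  have a2 : c + t • d + (-t) • d = c := by ext a; simp
  have b (s : ℝ) : ∑ a, w a * (s • d) a = s * ∑ a, w a * d a := by
    rw [Finset.mul_sum]
    exact Finset.sum_congr rfl fun a _ => by simp; ring
  rw [a1, b] at e1
  rw [a2, b] at e2
  have e1' := mul_le_mul_of_nonneg_left e1 h0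
  have e2' := mul_le_mul_of_nonneg_left e2 (sub_nonneg.2 h1)
  linarith

theorem le_midpoint (hH : HasSubgradients H) (c d : ι → ℝ) :
    H c ≤ 1 / 2 * H (c + d) + 1 / 2 * H (c - d) := by
  have := hH.le_mix (c - d) ((2 : ℝ) • d) (t := 1 / 2) (by norm_num) (by norm_num)
  have a1 : c - d + (1 / 2 : ℝ) • (2 : ℝ) • d = c := by ext a; simp
  have a2 : c - d + (2 : ℝ) • d = c + d := by ext a; simp; ring
  rw [a1, a2] at this
  linarith

theorem jensen (hH : HasSubgradients H) {Ω : Type*} [Fintype Ω] {p : Ω → ℝ}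
    (hp : p ∈ stdSimplex ℝ Ω) (c : ι → ℝ) (g : Ω → ι → ℝ) :
    H (c + ∑ x, p x • g x) ≤ ∑ x, p x * H (c + g x) := by
  set d := ∑ x, p x • g x with hd
  obtain ⟨w, -, h⟩ := hH (c + d)
  have e (x) : H (c + d) + ∑ a, w a * (g x a - d a) ≤ H (c + g x) := by
    simpa using h (g x - d)
  have e2 : ∑ x, p x * (H (c + d) + ∑ a, w a * (g x a - d a)) = H (c + d) := by
    have : ∑ x, p x * ∑ a, w a * (g x a - d a) = 0 := by
      simp_rw [Finset.mul_sum]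
      rw [Finset.sum_comm]
      refine Finset.sum_eq_zero fun a _ => ?_
      have : ∑ x, p x * (w a * (g x a - d a)) = w a * (∑ x, p x * g x a - (∑ x, p x) * d a) := by
        rw [Finset.sum_mul, ← Finset.sum_sub_distrib, Finset.mul_sum]
        exact Finset.sum_congr rfl fun x _ => by ring
      rw [this, hp.2, hd]
      simp
    simp_rw [mul_add]
    rw [Finset.sum_add_distrib, this, ← Finset.sum_mul, hp.2]
    ring
  rw [← e2]
  exact Finset.sum_le_sum fun x _ => mul_le_mul_of_nonneg_left (e x) (hp.1 x)

end HasSubgradients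

/-! ### Real inequalities -/

theorem nonneg_of_second_deriv_nonneg {g g' g'' : ℝ → ℝ} (h1 : ∀ x, HasDerivAt g (g' x) x)
    (h2 : ∀ x, HasDerivAt g' (g'' x) x) (h0 : ∀ x, 0 ≤ x → 0 ≤ g'' x) (hg : g 0 = 0)
    (hg' : g' 0 = 0) {x : ℝ} (hx : 0 ≤ x) : 0 ≤ g x := by
  have key : ∀ {u u' : ℝ → ℝ}, (∀ x, HasDerivAt u (u' x) x) → (∀ x, 0 ≤ x → 0 ≤ u' x) → u 0 = 0 →
      ∀ x, 0 ≤ x → 0 ≤ u x := by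
    intro u u' hu hu' hu0 x hx
    have hm : MonotoneOn u (Set.Ici 0) := by
      refine monotoneOn_of_deriv_nonneg (convex_Ici 0)
        (fun y _ => (hu y).continuousAt.continuousWithinAt)
        (fun y _ => (hu y).differentiableAt.differentiableWithinAt) fun y hy => ?_
      rw [(hu y).deriv]
      rw [interior_Ici] at hy
      exact hu' y hy.le
    rw [← hu0]
    exact hm Set.self_mem_Ici hx hx
  exact key h1 (key h2 h0 hg') hg x hx

/-- The second derivative of the difference in `l` is `y² (e^l - e^{ly})`, which is nonnegative
because `y ≤ 1`. No lower bound on `y` is needed, as in Bennett's inequality. -/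
theorem exp_mul_le {y l : ℝ} (hy : y ≤ 1) (hl : 0 ≤ l) :
    Real.exp (l * y) ≤ 1 + l * y + (Real.exp l - l - 1) * y ^ 2 := by
  have h := nonneg_of_second_deriv_nonneg
    (g := fun l => 1 + l * y + (Real.exp l - l - 1) * y ^ 2 - Real.exp (l * y))
    (g' := fun l => y + (Real.exp l - 1) * y ^ 2 - Real.exp (l * y) * y)
    (g'' := fun l => Real.exp l * y ^ 2 - Real.exp (l * y) * y * y)
    (fun x => by
      have := ((((hasDerivAt_id x).mul_const y).const_add 1).add
        ((((Real.hasDerivAt_exp x).sub (hasDerivAt_id x)).sub_const 1).mul_const (y ^ 2))).sub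
        (((hasDerivAt_id x).mul_const y).exp)
      exact this.congr_deriv (by simp))
    (fun x => by
      have := ((((Real.hasDerivAt_exp x).sub_const 1).mul_const (y ^ 2)).const_add y).sub
        ((((hasDerivAt_id x).mul_const y).exp).mul_const y)
      exact this.congr_deriv (by simp))
    (fun x hx => by
      have : Real.exp (x * y) ≤ Real.exp x := Real.exp_le_exp.2 (by nlinarith)
      nlinarith [mul_le_mul_of_nonneg_right this (sq_nonneg y)])
    (by simp) (by simp) hl
  linarith

/-- The second derivative of the difference is `(1 - (1 - l) e^l) / 3 ≥ 0`. This is the source of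
the scale `1 / 3` in `bernstein_tail`. -/
theorem exp_sub_le {l : ℝ} (hl : 0 ≤ l) :
    (1 - l / 3) * (Real.exp l - l - 1) ≤ l ^ 2 / 2 := by
  have h := nonneg_of_second_deriv_nonneg
    (g := fun l => l ^ 2 / 2 - (1 - l / 3) * (Real.exp l - l - 1))
    (g' := fun l => l - ((-(1 / 3)) * (Real.exp l - l - 1) + (1 - l / 3) * (Real.exp l - 1)))
    (g'' := fun l => 1 - ((-(1 / 3)) * (Real.exp l - 1) +
      ((-(1 / 3)) * (Real.exp l - 1) + (1 - l / 3) * Real.exp l)))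
    (fun x => by
      have := (((hasDerivAt_id x).pow 2).div_const 2).sub
        ((((hasDerivAt_id x).div_const 3).const_sub 1).mul
        (((Real.hasDerivAt_exp x).sub (hasDerivAt_id x)).sub_const 1))
      exact this.congr_deriv (by simp))
    (fun x => by
      have := (hasDerivAt_id x).sub
        (((((Real.hasDerivAt_exp x).sub (hasDerivAt_id x)).sub_const 1).const_mul (-(1 / 3))).add
        ((((hasDerivAt_id x).div_const 3).const_sub 1).mul
        ((Real.hasDerivAt_exp x).sub_const 1)))
      exact this.congr_deriv (by simp))
    (fun x hx => by
      have h1 : 1 - x ≤ Real.exp (-x) := by linarith [Real.add_one_le_exp (-x)]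
      have h2 : Real.exp (-x) * Real.exp x = 1 := by rw [← Real.exp_add]; simp
      nlinarith [mul_le_mul_of_nonneg_right h1 (Real.exp_pos x).le])
    (by simp) (by simp) hl
  linarith

/-- A convex function lies below its chord, here over `[0, l]`. -/
theorem exp_neg_le_sub {l u : ℝ} (hl : 0 < l) (h0 : 0 ≤ u) (h1 : u ≤ l) :
    Real.exp (-u) ≤ 1 - (1 - Real.exp (-l)) / l * u := by
  have hc := convexOn_exp.2 (Set.mem_univ (-l)) (Set.mem_univ (0 : ℝ))
    (div_nonneg h0 hl.le) (sub_nonneg.2 ((div_le_one hl).2 h1)) (by ring)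
  have e : (u / l) • (-l) + (1 - u / l) • (0 : ℝ) = -u := by
    simp only [smul_eq_mul]; field_simp; ring
  rw [e] at hc
  simp only [smul_eq_mul, Real.exp_zero] at hc
  have : (1 - Real.exp (-l)) / l * u = u / l * (1 - Real.exp (-l)) := by ring
  linarith

/-- For `d ≤ 1` use `cosh d ≤ exp (d² / 2)`: comparing `p` with `d`, one of the two bounds on `T`
gives `T ≤ 2d - d²`. For `d ≥ 1` only `T ≤ 2p - p² ≤ 1` matters, since `cosh d ≤ e^{d-1} cosh 1 ≤
e^{d-1/2}`. -/
theorem cosh_le_exp_of_le {d p T : ℝ} (hd : 0 ≤ d) (h1 : T ≤ 2 * d - p ^ 2)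
    (h2 : T ≤ 2 * p - p ^ 2) : Real.cosh d ≤ Real.exp (d - T / 2) := by
  rcases le_total d 1 with h | h
  · refine (Real.cosh_le_exp_half_sq d).trans (Real.exp_le_exp.2 ?_)
    rcases le_total p d with hp | hp
    · nlinarith
    · nlinarith
  · have hT : T ≤ 1 := by nlinarith [sq_nonneg (p - 1)]
    have hc : Real.cosh d ≤ Real.exp (d - 1) * Real.cosh 1 := by
      rw [Real.cosh_eq, Real.cosh_eq, mul_div_assoc', mul_add, ← Real.exp_add, ← Real.exp_add]
      have : Real.exp (-d) ≤ Real.exp (d - 1 + -1) := Real.exp_le_exp.2 (by linarith)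
      have e : d - 1 + 1 = d := by ring
      rw [e]
      linarith
    refine hc.trans ((mul_le_mul_of_nonneg_left (Real.cosh_le_exp_half_sq 1)
      (Real.exp_pos _).le).trans ?_)
    rw [← Real.exp_add]
    exact Real.exp_le_exp.2 (by linarith)

/-! ### Exponential inequalities -/

section Inequalities

variable {Ω ι : Type*} [Fintype Ω] [Fintype ι] {p : Ω → ℝ} {H : (ι → ℝ) → ℝ}

/-- The normalized increment `y` of `H` is at most `1` and dominates the linear increment `z` given
by a subgradient at `c`, and `z` is centered with second moment at most `s`. Bounding `y²` through
`z²` replaces the uncontrolled second moment of `y` by `s`, at the price of a term linear in `y`;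
that term is absorbed by enlarging the scale from `l` to `l + 2 (e^l - l - 1)`. -/
theorem HasSubgradients.bennett_step (hp : p ∈ stdSimplex ℝ Ω) (hH : HasSubgradients H)
    {f : Ω → ι → ℝ} (hf : ∀ x a, f x a ≤ 1) (hmean : ∀ a, ∑ x, p x * f x a = 0) {s l : ℝ}
    (hvar : ∀ a, ∑ x, p x * f x a ^ 2 ≤ s) (hl : 0 < l) (c : ι → ℝ) :
    ∑ x, p x * Real.exp (H (c + l • f x)) ≤
      Real.exp ((Real.exp l - l - 1) * s +
        ∑ x, p x * H (c + (l + 2 * (Real.exp l - l - 1)) • f x)) := by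
  set φ := Real.exp l - l - 1 with hφ
  have hφ0 : 0 ≤ φ := by have := Real.add_one_le_exp l; rw [hφ]; linarith
  obtain ⟨w, hw, hsub⟩ := hH c
  set y : Ω → ℝ := fun x => (H (c + l • f x) - H c) / l with hy
  set z : Ω → ℝ := fun x => ∑ a, w a * f x a with hz
  have hyl (x) : l * y x = H (c + l • f x) - H c := by rw [hy]; field_simp
  have hy1 (x) : y x ≤ 1 := by
    rw [hy, div_le_one hl]
    have := hH.le_add c (d := l • f x) (r := l) fun a => by
      simp only [Pi.smul_apply, smul_eq_mul]; nlinarith [hf x a]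
    linarith
  have hzy (x) : z x ≤ y x := by
    rw [hy, le_div_iff₀ hl, hz]
    have := hsub (l • f x)
    have e : ∑ a, w a * (l • f x) a = (∑ a, w a * f x a) * l := by
      rw [Finset.sum_mul]
      exact Finset.sum_congr rfl fun a _ => by simp; ring
    rw [e] at this
    linarith
  have hEz : ∑ x, p x * z x = 0 := by
    simp_rw [hz, Finset.mul_sum]
    rw [Finset.sum_comm]
    refine Finset.sum_eq_zero fun a _ => ?_
    have : ∑ x, p x * (w a * f x a) = w a * ∑ x, p x * f x a := by
      rw [Finset.mul_sum]; exact Finset.sum_congr rfl fun x _ => by ring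
    rw [this, hmean, mul_zero]
  have hz2 (x) : z x ^ 2 ≤ ∑ a, w a * f x a ^ 2 := by
    exact Real.pow_arith_mean_le_arith_mean_pow_of_even Finset.univ w (f x) (fun a _ => hw.1 a) hw.2
      even_two
  have hEz2 : ∑ x, p x * z x ^ 2 ≤ s := by
    calc ∑ x, p x * z x ^ 2 ≤ ∑ x, p x * ∑ a, w a * f x a ^ 2 :=
          Finset.sum_le_sum fun x _ => mul_le_mul_of_nonneg_left (hz2 x) (hp.1 x)
      _ = ∑ a, w a * ∑ x, p x * f x a ^ 2 := by
          simp_rw [Finset.mul_sum]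
          rw [Finset.sum_comm]
          exact Finset.sum_congr rfl fun x _ => Finset.sum_congr rfl fun a _ => by ring
      _ ≤ ∑ a, w a * s :=
          Finset.sum_le_sum fun a _ => mul_le_mul_of_nonneg_left (hvar a) (hw.1 a)
      _ = s := by rw [← Finset.sum_mul, hw.2, one_mul]
  -- From `z ≤ y ≤ 1` one has `(1 - y)² ≤ (1 - z)²`.
  have hy2 (x) : y x ^ 2 ≤ 2 * y x + z x ^ 2 - 2 * z x := by
    nlinarith [hzy x, hy1 x]
  have hexp (x) : Real.exp (H (c + l • f x)) ≤
      Real.exp (H c) * (1 + (l + 2 * φ) * y x + φ * (z x ^ 2 - 2 * z x)) := by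
    have e : H (c + l • f x) = H c + l * y x := by rw [hyl]; ring
    rw [e, Real.exp_add]
    refine mul_le_mul_of_nonneg_left ?_ (Real.exp_pos _).le
    have := exp_mul_le (hy1 x) hl.le
    have := mul_le_mul_of_nonneg_left (hy2 x) hφ0
    linarith
  -- Difference quotients of a convex function increase with the step, here from `l` to `l + 2φ`.
  have hmix (x) : (l + 2 * φ) * y x ≤ H (c + (l + 2 * φ) • f x) - H c := by
    have hpos : 0 < l + 2 * φ := by linarith
    have := hH.le_mix c ((l + 2 * φ) • f x) (t := l / (l + 2 * φ)) (by positivity)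
      ((div_le_one hpos).2 (by linarith))
    rw [smul_smul, div_mul_cancel₀ _ hpos.ne'] at this
    have h2 : l * y x ≤ l / (l + 2 * φ) * (H (c + (l + 2 * φ) • f x) - H c) := by
      rw [hyl]; linarith
    rw [div_mul_eq_mul_div, le_div_iff₀ hpos, mul_assoc] at h2
    have := le_of_mul_le_mul_left h2 hl
    linarith
  have hE : ∑ x, p x * (1 + (l + 2 * φ) * y x + φ * (z x ^ 2 - 2 * z x)) =
      1 + (l + 2 * φ) * ∑ x, p x * y x + φ * ∑ x, p x * z x ^ 2 := by
    have : ∀ x, p x * (1 + (l + 2 * φ) * y x + φ * (z x ^ 2 - 2 * z x)) =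
        p x + (l + 2 * φ) * (p x * y x) + φ * (p x * z x ^ 2) - 2 * φ * (p x * z x) :=
      fun x => by ring
    simp_rw [this]
    rw [Finset.sum_sub_distrib, Finset.sum_add_distrib, Finset.sum_add_distrib, hp.2,
      ← Finset.mul_sum, ← Finset.mul_sum, ← Finset.mul_sum, hEz]
    ring
  calc ∑ x, p x * Real.exp (H (c + l • f x))
      ≤ ∑ x, p x * (Real.exp (H c) * (1 + (l + 2 * φ) * y x + φ * (z x ^ 2 - 2 * z x))) :=
        Finset.sum_le_sum fun x _ => mul_le_mul_of_nonneg_left (hexp x) (hp.1 x)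
    _ = Real.exp (H c) * (1 + (l + 2 * φ) * ∑ x, p x * y x + φ * ∑ x, p x * z x ^ 2) := by
        rw [← hE, Finset.mul_sum]
        exact Finset.sum_congr rfl fun x _ => by ring
    _ ≤ Real.exp (H c) * Real.exp (∑ x, p x * (H (c + (l + 2 * φ) • f x) - H c) + φ * s) := by
        refine mul_le_mul_of_nonneg_left ?_ (Real.exp_pos _).le
        have h1 : (l + 2 * φ) * ∑ x, p x * y x ≤
            ∑ x, p x * (H (c + (l + 2 * φ) • f x) - H c) := by
          rw [Finset.mul_sum]
          refine Finset.sum_le_sum fun x _ => ?_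
          have := mul_le_mul_of_nonneg_left (hmix x) (hp.1 x)
          linarith
        have h2 := mul_le_mul_of_nonneg_left hEz2 hφ0
        have := Real.add_one_le_exp
          (∑ x, p x * (H (c + (l + 2 * φ) • f x) - H c) + φ * s)
        linarith
    _ = _ := by
        rw [← Real.exp_add]
        congr 1
        simp_rw [mul_sub]
        rw [Finset.sum_sub_distrib, ← Finset.sum_mul, hp.2]
        ring

/-- The exponential form of Bousquet's inequality. -/
theorem HasSubgradients.bousquet (hp : p ∈ stdSimplex ℝ Ω) (hH : HasSubgradients H)
    {f : Ω → ι → ℝ} (hf : ∀ x a, f x a ≤ 1) (hmean : ∀ a, ∑ x, p x * f x a = 0) {s l : ℝ}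
    (hvar : ∀ a, ∑ x, p x * f x a ^ 2 ≤ s) (hl : 0 < l) (m : ℕ) (c : ι → ℝ) :
    pexp p m (fun x => Real.exp (H (c + l • ∑ i, f (x i)))) ≤
      Real.exp (m * ((Real.exp l - l - 1) * s) +
        pexp p m fun x => H (c + (l + 2 * (Real.exp l - l - 1)) • ∑ i, f (x i))) := by
  induction m generalizing c with
  | zero => simp [pexp_zero]
  | succ m ih =>
    set φ := Real.exp l - l - 1
    -- The remaining coordinates already carry the enlarged scale, while the first still has scale
    -- `l`; the single step applied to `K` enlarges it once, so the enlargements do not compound.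
    set K : (ι → ℝ) → ℝ := fun c => pexp p m fun x => H (c + (l + 2 * φ) • ∑ i, f (x i))
    have hK : HasSubgradients K := HasSubgradients.average hp fun x => hH.shift _
    rw [pexp_succ, pexp_succ]
    simp only [Fin.sum_univ_succ, Fin.cons_zero, Fin.cons_succ, smul_add, ← add_assoc]
    calc ∑ a, p a * pexp p m (fun x => Real.exp (H (c + l • f a + l • ∑ i, f (x i))))
        ≤ ∑ a, p a * Real.exp (m * (φ * s) + K (c + l • f a)) :=
          Finset.sum_le_sum fun a _ => mul_le_mul_of_nonneg_left (ih _) (hp.1 a)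
      _ = Real.exp (m * (φ * s)) * ∑ a, p a * Real.exp (K (c + l • f a)) := by
          rw [Finset.mul_sum]
          exact Finset.sum_congr rfl fun a _ => by rw [Real.exp_add]; ring
      _ ≤ Real.exp (m * (φ * s)) * Real.exp (φ * s + ∑ a, p a * K (c + (l + 2 * φ) • f a)) :=
          mul_le_mul_of_nonneg_left (hK.bennett_step hp hf hmean hvar hl c) (Real.exp_pos _).le
      _ = _ := by
          rw [← Real.exp_add]
          push_cast
          congr 1
          ring

/-- Jensen replaces the mean by an independent copy `f y`. Then `c - f x + f y` is the midpoint of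
`c + 2 f y` and `c - 2 f x`, which decouples the two copies. -/
theorem HasSubgradients.symmetrization_step (hp : p ∈ stdSimplex ℝ Ω) (hH : HasSubgradients H)
    (f : Ω → ι → ℝ) (c : ι → ℝ) :
    ∑ x, p x * H (c + (∑ y, p y • f y - f x)) ≤
      ∑ x, p x * (1 / 2 * H (c + (2 : ℝ) • f x) + 1 / 2 * H (c - (2 : ℝ) • f x)) := by
  have h1 (x) : H (c + (∑ y, p y • f y - f x)) ≤
      ∑ y, p y * (1 / 2 * H (c + (2 : ℝ) • f y) + 1 / 2 * H (c - (2 : ℝ) • f x)) := by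
    have e : c + (∑ y, p y • f y - f x) = c + -f x + ∑ y, p y • f y := by abel
    rw [e]
    refine (hH.jensen hp _ _).trans (Finset.sum_le_sum fun y _ =>
      mul_le_mul_of_nonneg_left ?_ (hp.1 y))
    have := hH.le_midpoint (c + -f x + f y) (f x + f y)
    have a1 : c + -f x + f y + (f x + f y) = c + (2 : ℝ) • f y := by ext; simp; ring
    have a2 : c + -f x + f y - (f x + f y) = c - (2 : ℝ) • f x := by ext; simp; ring
    rwa [a1, a2] at this
  refine (Finset.sum_le_sum fun x _ => mul_le_mul_of_nonneg_left (h1 x) (hp.1 x)).trans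
    (le_of_eq ?_)
  have h2 (x) : ∑ y, p y * (1 / 2 * H (c + (2 : ℝ) • f y) + 1 / 2 * H (c - (2 : ℝ) • f x)) =
      ∑ y, p y * (1 / 2 * H (c + (2 : ℝ) • f y)) + 1 / 2 * H (c - (2 : ℝ) • f x) := by
    simp_rw [mul_add]
    rw [Finset.sum_add_distrib, ← Finset.sum_mul, hp.2, one_mul]
  simp_rw [h2, mul_add (p _)]
  rw [Finset.sum_add_distrib, Finset.sum_add_distrib, ← Finset.sum_mul, hp.2, one_mul]

/-- Symmetrization. -/
theorem HasSubgradients.symmetrization (hp : p ∈ stdSimplex ℝ Ω) (hH : HasSubgradients H)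
    (f : Ω → ι → ℝ) (m : ℕ) (c : ι → ℝ) :
    pexp p m (fun x => H (c + ∑ i, (∑ y, p y • f y - f (x i)))) ≤
      pexp p m fun x => pexp signWeight m fun ε => H (c + (2 : ℝ) • ∑ i, sgn (ε i) • f (x i)) := by
  induction m generalizing c with
  | zero => simp [pexp_zero]
  | succ m ih =>
    set K : (ι → ℝ) → ℝ := fun c => pexp p m fun x =>
      pexp signWeight m fun ε => H (c + (2 : ℝ) • ∑ i, sgn (ε i) • f (x i)) with hKdef
    have hK : HasSubgradients K :=
      HasSubgradients.average hp fun x => HasSubgradients.average signWeight_mem fun ε => hH.shift _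
    rw [pexp_succ, pexp_succ]
    simp only [Fin.sum_univ_succ, Fin.cons_zero, Fin.cons_succ, smul_add, ← add_assoc]
    calc _ ≤ ∑ a, p a * K (c + (∑ y, p y • f y - f a)) :=
          Finset.sum_le_sum fun a _ => mul_le_mul_of_nonneg_left (ih _) (hp.1 a)
      _ ≤ _ := hK.symmetrization_step hp f c
      _ = _ := by
          refine Finset.sum_congr rfl fun a _ => ?_
          congr 1
          simp only [hKdef, rad_succ, pexp_add, pexp_const_mul, Fin.cons_zero, Fin.cons_succ]
          simp [sgn, sub_eq_add_neg]

/-- The sign-averaged increment of `H` at scale `l` lies in `[0, l]`, because `f` takes values in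
`[0, 1]`. On this interval the chord bounds `e^{-u}`, and convexity compares the increment at scale
`l` with the one at scale `1 - e^{-l}`. The result is the Laplace transform of a Poisson variable.
-/
theorem HasSubgradients.lower_tail_step (hp : p ∈ stdSimplex ℝ Ω) (hH : HasSubgradients H)
    {f : Ω → ι → ℝ} (hf : ∀ x a, f x a ∈ Set.Icc (0 : ℝ) 1) {l : ℝ} (hl : 0 < l) (c : ι → ℝ) :
    ∑ x, p x * Real.exp (-(1 / 2 * H (c + l • f x) + 1 / 2 * H (c - l • f x))) ≤
      Real.exp (-∑ x, p x * (1 / 2 * H (c + (1 - Real.exp (-l)) • f x) +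
        1 / 2 * H (c - (1 - Real.exp (-l)) • f x))) := by
  set κ := 1 - Real.exp (-l) with hκ
  have hκl : κ ≤ l := by have := Real.add_one_le_exp (-l); rw [hκ]; linarith
  have hκ0 : 0 ≤ κ := by rw [hκ, sub_nonneg, Real.exp_le_one_iff]; linarith
  set U : Ω → ℝ := fun x => 1 / 2 * H (c + l • f x) + 1 / 2 * H (c - l • f x) with hU
  have hU0 (x) : 0 ≤ U x - H c := sub_nonneg.2 (hH.le_midpoint c _)
  have hU1 (x) : U x - H c ≤ l := by
    have h1 := hH.le_add c (d := l • f x) (r := l) fun a => by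
      simp only [Pi.smul_apply, smul_eq_mul]; nlinarith [(hf x a).2]
    have h2 := hH.le_add c (d := -(l • f x)) (r := 0) fun a => by
      simp only [Pi.neg_apply, Pi.smul_apply, smul_eq_mul]; nlinarith [(hf x a).1]
    rw [← sub_eq_add_neg] at h2
    simp only [hU]
    linarith
  have ht1 : κ / l ≤ 1 := (div_le_one hl).2 hκl
  have hmix (x) : 1 / 2 * H (c + κ • f x) + 1 / 2 * H (c - κ • f x) ≤
      H c + κ / l * (U x - H c) := by
    have h1 := hH.le_mix c (l • f x) (div_nonneg hκ0 hl.le) ht1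
    have h2 := hH.le_mix c (-(l • f x)) (div_nonneg hκ0 hl.le) ht1
    rw [smul_neg, ← sub_eq_add_neg, ← sub_eq_add_neg] at h2
    rw [smul_smul, div_mul_cancel₀ _ hl.ne'] at h1 h2
    simp only [hU]
    linarith
  have hexp (x) : Real.exp (-U x) ≤ Real.exp (-H c) * (1 - κ / l * (U x - H c)) := by
    have e : -U x = -H c + -(U x - H c) := by ring
    rw [e, Real.exp_add]
    exact mul_le_mul_of_nonneg_left (exp_neg_le_sub hl (hU0 x) (hU1 x)) (Real.exp_pos _).le
  calc ∑ x, p x * Real.exp (-U x)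
      ≤ ∑ x, p x * (Real.exp (-H c) * (1 - κ / l * (U x - H c))) :=
        Finset.sum_le_sum fun x _ => mul_le_mul_of_nonneg_left (hexp x) (hp.1 x)
    _ = Real.exp (-H c) * (1 - ∑ x, p x * (κ / l * (U x - H c))) := by
        have hx (x) : p x * (Real.exp (-H c) * (1 - κ / l * (U x - H c))) =
            Real.exp (-H c) * p x - Real.exp (-H c) * (p x * (κ / l * (U x - H c))) := by ring
        simp_rw [hx]
        rw [Finset.sum_sub_distrib, ← Finset.mul_sum, ← Finset.mul_sum, hp.2]
        ring
    _ ≤ Real.exp (-H c) * Real.exp (-∑ x, p x * (κ / l * (U x - H c))) := by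
        refine mul_le_mul_of_nonneg_left ?_ (Real.exp_pos _).le
        have := Real.add_one_le_exp (-∑ x, p x * (κ / l * (U x - H c)))
        linarith
    _ = Real.exp (-∑ x, p x * (H c + κ / l * (U x - H c))) := by
        rw [← Real.exp_add]
        congr 1
        simp_rw [mul_add (p _)]
        rw [Finset.sum_add_distrib, ← Finset.sum_mul, hp.2]
        ring
    _ ≤ _ := by
        refine Real.exp_le_exp.2 (neg_le_neg (Finset.sum_le_sum fun x _ =>
          mul_le_mul_of_nonneg_left (hmix x) (hp.1 x)))

/-- The lower tail of an expected Rademacher average, as a function of the sample. -/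
theorem HasSubgradients.rademacher_lower_tail (hp : p ∈ stdSimplex ℝ Ω) (hH : HasSubgradients H)
    {f : Ω → ι → ℝ} (hf : ∀ x a, f x a ∈ Set.Icc (0 : ℝ) 1) {l : ℝ} (hl : 0 < l) (m : ℕ)
    (c : ι → ℝ) :
    pexp p m (fun x => Real.exp
        (-pexp signWeight m fun ε => H (c + l • ∑ i, sgn (ε i) • f (x i)))) ≤
      Real.exp (-pexp p m fun x => pexp signWeight m fun ε =>
        H (c + (1 - Real.exp (-l)) • ∑ i, sgn (ε i) • f (x i))) := by
  -- The signs are averaged inside the exponential, so fixing the first sample point changes the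
  -- functional to an average of two shifts rather than just moving `c`.
  induction m generalizing H with
  | zero => simp [pexp_zero]
  | succ m ih =>
    have step (K : (ι → ℝ) → ℝ) (hK : HasSubgradients K) := hK.lower_tail_step hp hf hl c
    generalize 1 - Real.exp (-l) = κ at ih step ⊢
    set K : (ι → ℝ) → ℝ := fun c => pexp p m fun x =>
      pexp signWeight m fun ε => H (c + κ • ∑ i, sgn (ε i) • f (x i)) with hKdef
    have hK : HasSubgradients K :=
      HasSubgradients.average hp fun x => HasSubgradients.average signWeight_mem fun ε => hH.shift _
    have hA (a : Ω) : HasSubgradients fun c =>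
        1 / 2 * H (c + l • f a) + 1 / 2 * H (c + -(l • f a)) := (hH.shift _).half (hH.shift _)
    rw [pexp_succ, pexp_succ]
    simp only [Fin.sum_univ_succ, Fin.cons_zero, Fin.cons_succ, smul_add, rad_succ]
    have e1 : sgn true = 1 := rfl
    have e2 : sgn false = -1 := rfl
    simp only [e1, e2, one_smul, neg_smul, smul_neg]
    calc _ ≤ ∑ a, p a * Real.exp (-(1 / 2 * K (c + l • f a) + 1 / 2 * K (c - l • f a))) := by
          refine Finset.sum_le_sum fun a _ => mul_le_mul_of_nonneg_left ?_ (hp.1 a)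
          have := ih (hA a)
          simp only [pexp_add, pexp_const_mul, add_right_comm] at this
          simp only [pexp_add, pexp_const_mul, hKdef, ← add_assoc, sub_eq_add_neg]
          exact this
      _ ≤ _ := step K hK
      _ = _ := by
          congr 2
          refine Finset.sum_congr rfl fun a _ => ?_
          simp only [hKdef, pexp_add, pexp_const_mul, sub_eq_add_neg, ← add_assoc]

/-- The left side is `exp (-mean) * cosh d`, with `d` half the difference of the two values of `H`.
A subgradient at `c + a - a²`, whose mean value on `a` is `q`, bounds the gain of that point over
the smaller value by both `2d - q²` and `2q - q²`; `cosh_le_exp_of_le` is made for this pair. No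
bound on `a` is required. -/
theorem HasSubgradients.sign_lower_tail_step (hH : HasSubgradients H) (a c : ι → ℝ) :
    1 / 2 * Real.exp (-H (c + a)) + 1 / 2 * Real.exp (-H (c - a)) ≤
      Real.exp (-(1 / 2 * H (c + a - a ^ 2) + 1 / 2 * H (c - a - a ^ 2))) := by
  have key : ∀ a : ι → ℝ, H (c - a) ≤ H (c + a) →
      1 / 2 * Real.exp (-H (c + a)) + 1 / 2 * Real.exp (-H (c - a)) ≤
      Real.exp (-(1 / 2 * H (c + a - a ^ 2) + 1 / 2 * H (c - a - a ^ 2))) := by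
    intro a hle
    obtain ⟨w, hw, hsub⟩ := hH (c + a - a ^ 2)
    set q := ∑ b, w b * a b
    have hq : q ^ 2 ≤ ∑ b, w b * a b ^ 2 :=
      Real.pow_arith_mean_le_arith_mean_pow_of_even Finset.univ w a (fun a _ => hw.1 a) hw.2
        even_two
    -- The two directions lead from the base point `c + a - a²` back to `c + a` and to `c - a`.
    have h1 := hsub (a ^ 2)
    have h2 := hsub (a ^ 2 - (2 : ℝ) • a)
    have a1 : c + a - a ^ 2 + a ^ 2 = c + a := by abel
    have a2 : c + a - a ^ 2 + (a ^ 2 - (2 : ℝ) • a) = c - a := by ext; simp; ring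
    have b1 : ∑ b, w b * (a ^ 2) b = ∑ b, w b * a b ^ 2 := rfl
    have b2 : ∑ b, w b * (a ^ 2 - (2 : ℝ) • a) b = ∑ b, w b * a b ^ 2 - 2 * q := by
      rw [Finset.mul_sum, ← Finset.sum_sub_distrib]
      exact Finset.sum_congr rfl fun b _ => by simp; ring
    rw [a1, b1] at h1
    rw [a2, b2] at h2
    have h3 : H (c - a - a ^ 2) ≤ H (c - a) := hH.mono fun b => by
      simp only [Pi.sub_apply, Pi.pow_apply]; nlinarith [sq_nonneg (a b)]
    set d := (H (c + a) - H (c - a)) / 2 with hd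
    have hcosh := cosh_le_exp_of_le (d := d) (p := q) (T := H (c + a - a ^ 2) - H (c - a))
      (by rw [hd]; linarith) (by rw [hd]; linarith) (by linarith)
    have e : 1 / 2 * Real.exp (-H (c + a)) + 1 / 2 * Real.exp (-H (c - a)) =
        Real.exp (-H (c - a) - d) * Real.cosh d := by
      rw [Real.cosh_eq, mul_div_assoc', mul_add, ← Real.exp_add, ← Real.exp_add]
      have x1 : -H (c - a) - d + d = -H (c - a) := by ring
      have x2 : -H (c - a) - d + -d = -H (c + a) := by rw [hd]; ring
      rw [x1, x2]
      ring
    rw [e]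
    refine (mul_le_mul_of_nonneg_left hcosh (Real.exp_pos _).le).trans ?_
    rw [← Real.exp_add]
    exact Real.exp_le_exp.2 (by linarith)
  rcases le_total (H (c - a)) (H (c + a)) with h | h
  · exact key a h
  · have := key (-a) (by simpa [sub_eq_add_neg] using h)
    simp only [sub_neg_eq_add, ← sub_eq_add_neg, neg_sq] at this
    rw [add_comm (1 / 2 * Real.exp _), add_comm (1 / 2 * H _)]
    exact this

/-- The lower tail of a supremum of Rademacher sums, in exponential form. -/
theorem HasSubgradients.sign_lower_tail (hH : HasSubgradients H) {m : ℕ} (a : Fin m → ι → ℝ)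
    (c : ι → ℝ) :
    pexp signWeight m (fun ε => Real.exp (-H (c + ∑ i, sgn (ε i) • a i))) ≤
      Real.exp (-pexp signWeight m fun ε => H (c + ∑ i, (sgn (ε i) • a i - a i ^ 2))) := by
  induction m generalizing c with
  | zero => simp [pexp_zero]
  | succ m ih =>
    set K : (ι → ℝ) → ℝ := fun c => pexp signWeight m fun ε =>
      H (c + ∑ i : Fin m, (sgn (ε i) • a i.succ - a i.succ ^ 2)) with hKdef
    have hK : HasSubgradients K := HasSubgradients.average signWeight_mem fun ε => hH.shift _
    simp only [rad_succ, pexp_add, pexp_const_mul, Fin.sum_univ_succ, Fin.cons_zero,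
      Fin.cons_succ]
    have e1 : sgn true = 1 := rfl
    have e2 : sgn false = -1 := rfl
    simp only [e1, e2, one_smul, neg_smul, ← add_assoc]
    refine (add_le_add (mul_le_mul_of_nonneg_left (ih (fun i => a i.succ) _) (by norm_num))
      (mul_le_mul_of_nonneg_left (ih (fun i => a i.succ) _) (by norm_num))).trans
      ((hK.sign_lower_tail_step (a 0) c).trans (le_of_eq ?_))
    simp only [hKdef, sub_eq_add_neg, ← add_assoc]

end Inequalities

/-! ### Tail bounds -/

section Tails

variable {Ω : Type*} [Fintype Ω] {p : Ω → ℝ} {m : ℕ}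

theorem pexp_indicator_le (hp : p ∈ stdSimplex ℝ Ω) {A : Set (Fin m → Ω)} {F : (Fin m → Ω) → ℝ}
    (h0 : ∀ x, 0 ≤ F x) (h1 : ∀ x ∈ A, 1 ≤ F x) : pexp p m (A.indicator 1) ≤ pexp p m F :=
  pexp_mono hp fun x => Set.indicator_le' (fun x hx => h1 x hx) (fun x _ => h0 x) x

theorem pexp_indicator_mono (hp : p ∈ stdSimplex ℝ Ω) {A B : Set (Fin m → Ω)} (h : A ⊆ B) :
    pexp p m (A.indicator 1) ≤ pexp p m (B.indicator 1) :=
  pexp_mono hp fun x => Set.indicator_le_indicator_of_subset h (fun _ => zero_le_one) x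

/-- The tail of a sub-gamma variable with scale `1 / 3`, as in Bernstein's inequality. -/
theorem bernstein_tail (hp : p ∈ stdSimplex ℝ Ω) {Z : (Fin m → Ω) → ℝ} {μ v L : ℝ} (hv : 0 ≤ v)
    (hL : 0 < L)
    (h : ∀ l, 0 < l → pexp p m (fun x => Real.exp (l * Z x)) ≤
      Real.exp (l * μ + (Real.exp l - l - 1) * v)) :
    pexp p m ({x | μ + √(2 * v * L) + L / 3 < Z x}.indicator 1) ≤ Real.exp (-L) := by
  have key : ∀ l, 0 < l → (Real.exp l - l - 1) * v - l * (√(2 * v * L) + L / 3) ≤ -L →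
      pexp p m ({x | μ + √(2 * v * L) + L / 3 < Z x}.indicator 1) ≤ Real.exp (-L) := by
    intro l hl hle
    set T := μ + √(2 * v * L) + L / 3 with hT
    calc pexp p m ({x | T < Z x}.indicator 1)
        ≤ pexp p m fun x => Real.exp (-(l * T)) * Real.exp (l * Z x) := by
          refine pexp_indicator_le hp (fun x => by positivity) fun x hx => ?_
          rw [← Real.exp_add, Real.one_le_exp_iff]
          have := mul_lt_mul_of_pos_left (Set.mem_ofPred.1 hx) hl
          linarith
      _ ≤ Real.exp (-(l * T)) * Real.exp (l * μ + (Real.exp l - l - 1) * v) := by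
          rw [pexp_const_mul]
          exact mul_le_mul_of_nonneg_left (h l hl) (Real.exp_pos _).le
      _ ≤ Real.exp (-L) := by
          rw [← Real.exp_add]
          refine Real.exp_le_exp.2 ?_
          rw [hT]
          linarith
  rcases hv.eq_or_lt with rfl | hv
  -- With zero variance the bound is `μ + L / 3`, and `l = 3` gives exactly `-L`.
  · refine key 3 (by norm_num) ?_
    simp
    linarith
  · set s := √(2 * L / v) with hs
    have hs0 : 0 < s := Real.sqrt_pos.2 (by positivity)
    have hs2 : s ^ 2 = 2 * L / v := Real.sq_sqrt (by positivity)
    have hLs : L = v * s ^ 2 / 2 := by rw [hs2]; field_simp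
    have hr : √(2 * v * L) = v * s := by
      rw [show 2 * v * L = (v * s) ^ 2 by rw [hLs]; ring, Real.sqrt_sq (by positivity)]
    have hd : 0 < 1 + s / 3 := by positivity
    -- This `l` makes `1 - l / 3 = l / s`, so that `exp_sub_le` becomes `e^l - l - 1 ≤ s l / 2` and
    -- the exponent comes out as at most `-L`.
    have hl0 : 0 < s / (1 + s / 3) := by positivity
    refine key _ hl0 ?_
    have h1 := exp_sub_le hl0.le
    set l := s / (1 + s / 3) with hl
    have hls : l * (1 + s / 3) = s := by rw [hl]; field_simp
    have h2 : (Real.exp l - l - 1) ≤ s * l / 2 := by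
      have e : 1 - l / 3 = l / s := by
        rw [hl]; field_simp; ring
      rw [e, div_mul_eq_mul_div, div_le_iff₀ hs0] at h1
      have : l * (Real.exp l - l - 1) ≤ l * (s * l / 2) := by nlinarith
      exact le_of_mul_le_mul_left this hl0
    have h3 := mul_le_mul_of_nonneg_right h2 hv.le
    rw [hr]
    have h4 : l * (v * s + L / 3) = v * s * l / 2 + v * s * (l * (1 + s / 3)) / 2 := by
      rw [hLs]; ring
    rw [h4, hls]
    nlinarith

/-- The lower tail of a nonnegative variable that is dominated by a Poisson variable. -/
theorem poisson_lower_tail (hp : p ∈ stdSimplex ℝ Ω) {Y : (Fin m → Ω) → ℝ} {μ L : ℝ}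
    (hY : ∀ x, 0 ≤ Y x) (hL : 0 < L)
    (h : ∀ l, 0 < l → pexp p m (fun x => Real.exp (-(l * Y x))) ≤
      Real.exp (-((1 - Real.exp (-l)) * μ))) :
    pexp p m ({x | Y x + L + √(L ^ 2 + 2 * L * Y x) < μ}.indicator 1) ≤ Real.exp (-L) := by
  rcases le_or_gt μ 0 with hμ | hμ
  · have : {x | Y x + L + √(L ^ 2 + 2 * L * Y x) < μ} = ∅ := by
      ext x
      have := hY x
      have := Real.sqrt_nonneg (L ^ 2 + 2 * L * Y x)
      simp
      linarith
    rw [this, Set.indicator_empty, pexp_const hp]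
    exact (Real.exp_pos _).le
  -- The event forces `Y < μ - t`: it is this tail solved for `μ`. The multiplier `t / μ` optimizes
  -- the quadratic bound on `e^{-l}`.
  set t := √(2 * L * μ) with ht
  have ht2 : t ^ 2 = 2 * L * μ := Real.sq_sqrt (by positivity)
  have ht0 : 0 < t := Real.sqrt_pos.2 (by positivity)
  have hl : 0 < t / μ := by positivity
  calc pexp p m ({x | Y x + L + √(L ^ 2 + 2 * L * Y x) < μ}.indicator 1)
      ≤ pexp p m fun x => Real.exp (t / μ * (μ - t)) * Real.exp (-(t / μ * Y x)) := by
        refine pexp_indicator_le hp (fun x => by positivity) fun x hx => ?_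
        have hx : Y x + L + √(L ^ 2 + 2 * L * Y x) < μ := hx
        have hyx := hY x
        have hq := Real.sqrt_nonneg (L ^ 2 + 2 * L * Y x)
        have hq2 : √(L ^ 2 + 2 * L * Y x) ^ 2 = L ^ 2 + 2 * L * Y x := Real.sq_sqrt (by positivity)
        have hlt : t < μ - Y x := by
          refine lt_of_pow_lt_pow_left₀ 2 (by linarith) ?_
          rw [ht2]
          have : √(L ^ 2 + 2 * L * Y x) < μ - Y x - L := by linarith
          nlinarith
        rw [← Real.exp_add, Real.one_le_exp_iff]
        have := mul_nonneg hl.le (sub_nonneg.2 hlt.le)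
        linarith
    _ ≤ Real.exp (t / μ * (μ - t)) * Real.exp (-((1 - Real.exp (-(t / μ))) * μ)) := by
        rw [pexp_const_mul]
        exact mul_le_mul_of_nonneg_left (h _ hl) (Real.exp_pos _).le
    _ ≤ Real.exp (-L) := by
        rw [← Real.exp_add]
        refine Real.exp_le_exp.2 ?_
        have hq : Real.exp (-(t / μ)) ≤ 1 - t / μ + (t / μ) ^ 2 / 2 := by
          have := nonneg_of_second_deriv_nonneg
            (g := fun l => 1 - l + l ^ 2 / 2 - Real.exp (-l))
            (g' := fun l => -1 + l - Real.exp (-l) * (-1))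
            (g'' := fun l => 1 - Real.exp (-l) * (-1) * (-1))
            (fun x => (((hasDerivAt_id x).const_sub 1).add
              (((hasDerivAt_id x).pow 2).div_const 2)).sub
              ((hasDerivAt_id x).neg.exp) |>.congr_deriv (by simp))
            (fun x => ((hasDerivAt_id x).const_add (-1)).sub
              (((hasDerivAt_id x).neg.exp).mul_const (-1)) |>.congr_deriv (by simp))
            (fun x hx => by
              have : Real.exp (-x) ≤ 1 := Real.exp_le_one_iff.2 (by linarith)
              linarith)
            (by simp) (by simp) hl.le
          linarith
        have hq2 := mul_le_mul_of_nonneg_right hq hμ.le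
        have e1 : t / μ * μ = t := by field_simp
        have e2 : (t / μ) ^ 2 * μ = 2 * L := by
          rw [div_pow, ht2]; field_simp
        have e3 : t / μ * t = 2 * L := by
          rw [div_mul_eq_mul_div, ← sq, ht2]; field_simp
        nlinarith

/-- The lower tail of a sub-Gaussian variable. -/
theorem gaussian_lower_tail (hp : p ∈ stdSimplex ℝ Ω) {Z : (Fin m → Ω) → ℝ} {μ s L : ℝ}
    (hs : 0 ≤ s) (hL : 0 < L)
    (h : ∀ l, 0 < l → pexp p m (fun x => Real.exp (-(l * Z x))) ≤
      Real.exp (-(l * μ) + l ^ 2 * s)) :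
    pexp p m ({x | Z x + √(4 * s * L) < μ}.indicator 1) ≤ Real.exp (-L) := by
  have key : ∀ l t, 0 < l → (∀ x, Z x + √(4 * s * L) < μ → t ≤ μ - Z x) → l ^ 2 * s - l * t ≤ -L →
      pexp p m ({x | Z x + √(4 * s * L) < μ}.indicator 1) ≤ Real.exp (-L) := by
    intro l t hl ht hle
    calc pexp p m ({x | Z x + √(4 * s * L) < μ}.indicator 1)
        ≤ pexp p m fun x => Real.exp (l * (μ - t)) * Real.exp (-(l * Z x)) := by
          refine pexp_indicator_le hp (fun x => by positivity) fun x hx => ?_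
          rw [← Real.exp_add, Real.one_le_exp_iff]
          have := mul_nonneg hl.le (sub_nonneg.2 (ht x hx))
          linarith
      _ ≤ Real.exp (l * (μ - t)) * Real.exp (-(l * μ) + l ^ 2 * s) := by
          rw [pexp_const_mul]
          exact mul_le_mul_of_nonneg_left (h l hl) (Real.exp_pos _).le
      _ ≤ Real.exp (-L) := by
          rw [← Real.exp_add]
          exact Real.exp_le_exp.2 (by linarith)
  rcases hs.eq_or_lt with rfl | hs
  · rcases Set.eq_empty_or_nonempty {x | Z x + √(4 * 0 * L) < μ} with he | hne
    · rw [he, Set.indicator_empty, pexp_const hp]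
      exact (Real.exp_pos _).le
    · obtain ⟨x, hx, hmin⟩ := Set.exists_min_image _ (fun x => μ - Z x) (Set.toFinite _) hne
      have hg : 0 < μ - Z x := by
        have : Z x + √(4 * 0 * L) < μ := hx
        simp at this
        linarith
      refine key (L / (μ - Z x)) (μ - Z x) (by positivity) (fun y hy => hmin y hy) ?_
      rw [div_mul_cancel₀ _ hg.ne']
      simp
  · set t := √(4 * s * L) with ht
    have ht2 : t ^ 2 = 4 * s * L := Real.sq_sqrt (by positivity)
    have ht0 : 0 < t := Real.sqrt_pos.2 (by positivity)
    -- The minimizer of `l² s - l t`; the minimum is `-t² / (4s) = -L`.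
    refine key (t / (2 * s)) t (by positivity) (fun x hx => by linarith) ?_
    have e1 : (t / (2 * s)) ^ 2 * s = L := by rw [div_pow, ht2]; field_simp; ring
    have e2 : t / (2 * s) * t = 2 * L := by
      rw [div_mul_eq_mul_div, ← sq, ht2]; field_simp; ring
    rw [e1, e2]
    linarith

end Tails

/-! ### Deviations of Rademacher averages -/

/-- The uniform weights on vectors of `c` signs. -/
def signsWeight (c : ℕ) (_ : Fin c → Bool) : ℝ := ∏ _x : Fin c, 1 / 2

theorem signsWeight_mem (c : ℕ) : signsWeight c ∈ stdSimplex ℝ (Fin c → Bool) :=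
  prod_mem_stdSimplex signWeight_mem c

/-- Independence of the rows of the sign matrix. The matrix is sampled by columns, so it has to be
transposed. -/
theorem pexp_signsWeight_prod {c m : ℕ} (F : Fin c → (Fin m → Bool) → ℝ) :
    pexp (signsWeight c) m (fun σ => ∏ x, F x fun i => σ i x) =
      ∏ x, pexp signWeight m (F x) := by
  classical
  unfold pexp
  rw [Finset.prod_univ_sum, Fintype.piFinset_univ,
    ← (Equiv.piComm fun (_ : Fin c) (_ : Fin m) => Bool).sum_comp]
  refine Finset.sum_congr rfl fun σ _ => ?_
  rw [Finset.prod_mul_distrib]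
  simp only [signsWeight, signWeight, Finset.prod_const, Finset.card_univ, Fintype.card_fin]
  rw [← pow_mul, ← pow_mul, mul_comm c m]
  rfl

section Rademacher

variable {Ω ι : Type*}

/-- The empirical Rademacher average of the functions `fun ω => f ω a`. -/
def era (f : Ω → ι → ℝ) {m : ℕ} (x : Fin m → Ω) : ℝ :=
  pexp signWeight m fun ε => ⨆ a, 1 / (m : ℝ) * ∑ i, sgn (ε i) * f (x i) a

/-- The Rademacher average of the functions `fun ω => f ω a`. -/
def rademacher [Fintype Ω] (p : Ω → ℝ) (f : Ω → ι → ℝ) (m : ℕ) : ℝ := pexp p m fun x => era f x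

theorem iSup_zero_add_smul {l : ℝ} (hl : 0 ≤ l) (y : ι → ℝ) :
    ⨆ a, ((0 : ι → ℝ) + l • y) a = l * ⨆ a, y a := by
  simp [Real.mul_iSup_of_nonneg hl]

theorem mul_era (f : Ω → ι → ℝ) {m : ℕ} (hm : 1 ≤ m) (x : Fin m → Ω) :
    m * era f x = pexp signWeight m fun ε => ⨆ a, (∑ i, sgn (ε i) • f (x i)) a := by
  have hm0 : (m : ℝ) ≠ 0 := by positivity
  rw [era, ← pexp_const_mul]
  congr 1
  ext ε
  rw [Real.mul_iSup_of_nonneg (by positivity)]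
  refine iSup_congr fun a => ?_
  rw [← mul_assoc, mul_one_div_cancel hm0, one_mul, Finset.sum_apply]
  rfl

variable [Fintype ι] [Nonempty ι]

/-- Pair each sign vector with its opposite: for any fixed function the two signed averages cancel,
so the two suprema have a nonnegative sum. -/
theorem era_nonneg (f : Ω → ι → ℝ) {m : ℕ} (x : Fin m → Ω) : 0 ≤ era f x := by
  rw [era, ← add_halves (pexp _ _ _)]
  nth_rewrite 2 [← rad_comp_not]
  rw [← add_div, ← pexp_add]
  refine div_nonneg (pexp_nonneg signWeight_mem fun ε => ?_) zero_le_two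
  have a := Classical.arbitrary ι
  have h1 := le_ciSup (f := fun a => 1 / (m : ℝ) * ∑ i, sgn (ε i) * f (x i) a)
    (Set.finite_range _).bddAbove a
  have h2 := le_ciSup (f := fun a => 1 / (m : ℝ) * ∑ i, sgn (!ε i) * f (x i) a)
    (Set.finite_range _).bddAbove a
  simp only [sgn_not, neg_mul, Finset.sum_neg_distrib, mul_neg] at h1 h2 ⊢
  linarith

/-- The Monte Carlo approximation of the empirical Rademacher average. -/
theorem mcera_tail (f : Ω → ι → ℝ) {m c : ℕ} (hm : 1 ≤ m) (hc : 1 ≤ c) (x : Fin m → Ω) {L : ℝ}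
    (hL : 0 < L) :
    pexp (signsWeight c) m ({σ | 1 / (c : ℝ) * (∑ y : Fin c, ⨆ a, 1 / (m : ℝ) *
        ∑ i, sgn (σ i y) * f (x i) a) +
        √(4 * (⨆ a, 1 / (m : ℝ) * ∑ i, f (x i) a ^ 2) * L / (c * m)) < era f x}.indicator 1) ≤
      Real.exp (-L) := by
  have hm0 : (0 : ℝ) < m := by exact_mod_cast hm
  have hc0 : (0 : ℝ) < c := by exact_mod_cast hc
  set w := ⨆ a, 1 / (m : ℝ) * ∑ i, f (x i) a ^ 2 with hw
  have hwa (a) : ∑ i, f (x i) a ^ 2 ≤ m * w := by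
    have := le_ciSup (f := fun a => 1 / (m : ℝ) * ∑ i, f (x i) a ^ 2)
      (Set.finite_range _).bddAbove a
    rw [one_div_mul_eq_div, div_le_iff₀ hm0] at this
    linarith
  have hw0 : 0 ≤ w := Real.iSup_nonneg fun a =>
    mul_nonneg (by positivity) (Finset.sum_nonneg fun i _ => sq_nonneg _)
  set Z : (Fin m → Bool) → ℝ := fun ε => ⨆ a, (∑ i, sgn (ε i) • f (x i)) a with hZ
  have hone (l : ℝ) (hl : 0 < l) : pexp signWeight m (fun ε => Real.exp (-(l * Z ε))) ≤
      Real.exp (-(l * (m * era f x)) + l ^ 2 * (m * w)) := by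
    have h := HasSubgradients.sign_lower_tail (HasSubgradients.iSup (ι := ι))
      (fun i => l • f (x i)) 0
    have e (ε : Fin m → Bool) : ⨆ a, ((0 : ι → ℝ) + ∑ i, sgn (ε i) • l • f (x i)) a = l * Z ε := by
      rw [← iSup_zero_add_smul hl.le, Finset.smul_sum]
      simp_rw [smul_comm l]
    simp only [e] at h
    refine h.trans (Real.exp_le_exp.2 ?_)
    rw [mul_era f hm, ← pexp_const_mul, ← neg_le_neg_iff, neg_neg, neg_add, neg_neg,
      ← pexp_const signWeight_mem (m := m) (-(l ^ 2 * (m * w))), ← pexp_add]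
    refine pexp_mono signWeight_mem fun ε => ?_
    -- Removing the corrections `(l f)²` costs at most their largest total over the class, which is
    -- `l² m w`.
    have := (HasSubgradients.iSup (ι := ι)).le_add
      (0 + ∑ i, (sgn (ε i) • l • f (x i) - (l • f (x i)) ^ 2))
      (d := ∑ i, (l • f (x i)) ^ 2) (r := l ^ 2 * (m * w)) fun a => by
        have h2 := mul_le_mul_of_nonneg_left (hwa a) (sq_nonneg l)
        rw [Finset.mul_sum] at h2
        simpa [mul_pow] using h2
    rw [add_assoc, ← Finset.sum_add_distrib] at this
    simp only [sub_add_cancel] at this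
    rw [e] at this
    linarith
  have htail := gaussian_lower_tail (signsWeight_mem c) (m := m)
    (Z := fun σ => ∑ y, Z fun i => σ i y) (μ := c * (m * era f x)) (s := c * (m * w)) (L := L)
    (by positivity) hL fun l hl => by
      simp_rw [Finset.mul_sum, ← Finset.sum_neg_distrib, Real.exp_sum]
      rw [pexp_signsWeight_prod fun _ ε => Real.exp (-(l * Z ε)), Finset.prod_const,
        Finset.card_univ, Fintype.card_fin]
      refine (pow_le_pow_left₀ (pexp_nonneg signWeight_mem fun _ => (Real.exp_pos _).le)
        (hone l hl) c).trans (le_of_eq ?_)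
      rw [← Real.exp_nat_mul]
      congr 1
      ring
  refine (pexp_indicator_mono (signsWeight_mem c) fun σ hσ => ?_).trans htail
  simp only [Set.mem_ofPred_eq] at hσ ⊢
  have h1 : (c * m : ℝ) * (1 / (c : ℝ) * ∑ y : Fin c, ⨆ a, 1 / (m : ℝ) *
      ∑ i, sgn (σ i y) * f (x i) a) = ∑ y, Z fun i => σ i y := by
    rw [mul_mul_mul_comm, mul_one_div_cancel hc0.ne', one_mul, Finset.mul_sum]
    refine Finset.sum_congr rfl fun y _ => ?_
    rw [Real.mul_iSup_of_nonneg hm0.le]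
    refine iSup_congr fun a => ?_
    rw [← mul_assoc, mul_one_div_cancel hm0.ne', one_mul, Finset.sum_apply]
    rfl
  have h2 : (c * m : ℝ) * √(4 * w * L / (c * m)) = √(4 * (c * (m * w)) * L) := by
    rw [← Real.sqrt_sq (mul_pos hc0 hm0).le, ← Real.sqrt_mul (sq_nonneg _),
      Real.sqrt_sq (mul_pos hc0 hm0).le]
    congr 1
    field_simp
  have h3 := mul_lt_mul_of_pos_left hσ (mul_pos hc0 hm0)
  rw [mul_add, h1, h2] at h3
  linarith

/-- Rescaling of the bound of `poisson_lower_tail`. -/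
theorem mul_poisson_bound {m L y : ℝ} (hm : 0 < m) :
    m * (y + L / m + √((L / m) ^ 2 + 2 * L * y / m)) =
      m * y + L + √(L ^ 2 + 2 * L * (m * y)) := by
  have : m * √((L / m) ^ 2 + 2 * L * y / m) = √(L ^ 2 + 2 * L * (m * y)) := by
    rw [← Real.sqrt_sq hm.le, ← Real.sqrt_mul (sq_nonneg _), Real.sqrt_sq hm.le]
    congr 1
    field_simp
  rw [mul_add, mul_add, this]
  field_simp

variable [Fintype Ω] {p : Ω → ℝ}

/-- By `rademacher_lower_tail`, `m` times the empirical average has the Laplace bound of a Poisson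
variable; positive homogeneity of the supremum turns the scale `1 - e^{-l}` into a factor. -/
theorem era_tail (hp : p ∈ stdSimplex ℝ Ω) {f : Ω → ι → ℝ}
    (hf : ∀ x a, f x a ∈ Set.Icc (0 : ℝ) 1) {m : ℕ} (hm : 1 ≤ m) {L : ℝ} (hL : 0 < L) :
    pexp p m ({x | era f x + L / m + √((L / m) ^ 2 + 2 * L * era f x / m) <
      rademacher p f m}.indicator 1) ≤ Real.exp (-L) := by
  have hm0 : (0 : ℝ) < m := by exact_mod_cast hm
  have htail := poisson_lower_tail hp (m := m) (Y := fun x => m * era f x)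
    (μ := m * rademacher p f m) (fun x => mul_nonneg hm0.le (era_nonneg f x)) hL fun l hl => by
      have h := HasSubgradients.rademacher_lower_tail hp (HasSubgradients.iSup (ι := ι)) hf hl m 0
      have hκ : 0 ≤ 1 - Real.exp (-l) := by
        rw [sub_nonneg, Real.exp_le_one_iff]; linarith
      simp_rw [iSup_zero_add_smul hl.le, iSup_zero_add_smul hκ, pexp_const_mul, ← mul_era f hm] at h
      rwa [pexp_const_mul] at h
  refine (pexp_indicator_mono hp fun x hx => ?_).trans htail
  have h3 := mul_lt_mul_of_pos_left (Set.mem_ofPred.1 hx) hm0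
  rwa [mul_poisson_bound hm0] at h3

/-- One function attaining the true maximum suffices, and no union bound over the class is paid: its
empirical second moment is at most the empirical supremum, and the bound is monotone in that
quantity. For one function the sum is over independent terms in `[0, 1]`. -/
theorem wimpy_tail (hp : p ∈ stdSimplex ℝ Ω) {f : Ω → ι → ℝ}
    (hf : ∀ x a, f x a ∈ Set.Icc (0 : ℝ) 1) {m : ℕ} (hm : 1 ≤ m) {L : ℝ} (hL : 0 < L) :
    pexp p m ({x | varBound (⨆ a, 1 / (m : ℝ) * ∑ i, f (x i) a ^ 2) L m <
      ⨆ a, ∑ ω, p ω * f ω a ^ 2}.indicator 1) ≤ Real.exp (-L) := by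
  have hm0 : (0 : ℝ) < m := by exact_mod_cast hm
  obtain ⟨a, ha⟩ := exists_eq_ciSup_of_finite (f := fun a => ∑ ω, p ω * f ω a ^ 2)
  have htail := poisson_lower_tail hp (m := m) (Y := fun x => ∑ i, f (x i) a ^ 2)
    (μ := m * ∑ ω, p ω * f ω a ^ 2) (fun x => Finset.sum_nonneg fun i _ => sq_nonneg _) hL
    fun l hl => by
      have e (x : Fin m → Ω) : Real.exp (-(l * ∑ i, f (x i) a ^ 2)) =
          ∏ i, Real.exp (-(l * f (x i) a ^ 2)) := by
        rw [Finset.mul_sum, ← Finset.sum_neg_distrib, Real.exp_sum]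
      simp_rw [e]
      rw [pexp_prod p m fun ω => Real.exp (-(l * f ω a ^ 2))]
      have hκ (ω) : Real.exp (-(l * f ω a ^ 2)) ≤ 1 - (1 - Real.exp (-l)) * f ω a ^ 2 := by
        have h1 : f ω a ^ 2 ≤ 1 := pow_le_one₀ (hf ω a).1 (hf ω a).2
        have := exp_neg_le_sub hl (u := l * f ω a ^ 2) (by positivity) (by nlinarith)
        have e : (1 - Real.exp (-l)) / l * (l * f ω a ^ 2) = (1 - Real.exp (-l)) * f ω a ^ 2 := by
          field_simp
        rwa [e] at this
      have hsum : ∑ ω, p ω * Real.exp (-(l * f ω a ^ 2)) ≤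
          Real.exp (-((1 - Real.exp (-l)) * ∑ ω, p ω * f ω a ^ 2)) := by
        calc _ ≤ ∑ ω, p ω * (1 - (1 - Real.exp (-l)) * f ω a ^ 2) :=
              Finset.sum_le_sum fun ω _ => mul_le_mul_of_nonneg_left (hκ ω) (hp.1 ω)
          _ = 1 - (1 - Real.exp (-l)) * ∑ ω, p ω * f ω a ^ 2 := by
              have e (ω) : p ω * (1 - (1 - Real.exp (-l)) * f ω a ^ 2) =
                  p ω - (1 - Real.exp (-l)) * (p ω * f ω a ^ 2) := by ring
              simp_rw [e]
              rw [Finset.sum_sub_distrib, ← Finset.mul_sum, hp.2]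
          _ ≤ _ := by
              have := Real.add_one_le_exp (-((1 - Real.exp (-l)) * ∑ ω, p ω * f ω a ^ 2))
              linarith
      refine (pow_le_pow_left₀ (Finset.sum_nonneg fun ω _ =>
        mul_nonneg (hp.1 ω) (Real.exp_pos _).le) hsum m).trans (le_of_eq ?_)
      rw [← Real.exp_nat_mul]
      congr 1
      ring
  refine (pexp_indicator_mono hp fun x hx => ?_).trans htail
  have hx := Set.mem_ofPred.1 hx
  rw [← ha] at hx
  have hle := le_ciSup (f := fun a => 1 / (m : ℝ) * ∑ i, f (x i) a ^ 2)
    (Set.finite_range _).bddAbove a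
  set w := ⨆ a, 1 / (m : ℝ) * ∑ i, f (x i) a ^ 2
  have h0 : 0 ≤ ∑ i, f (x i) a ^ 2 := Finset.sum_nonneg fun i _ => sq_nonneg _
  have h3 : 1 / (m : ℝ) * ∑ i, f (x i) a ^ 2 + L / m +
      √((L / m) ^ 2 + 2 * L * (1 / (m : ℝ) * ∑ i, f (x i) a ^ 2) / m) <
        ∑ ω, p ω * f ω a ^ 2 := by
    refine lt_of_le_of_lt ?_ hx
    unfold varBound
    have e : 2 * w * L = 2 * L * w := by ring
    rw [e]
    gcongr
  have h4 := mul_lt_mul_of_pos_left h3 hm0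
  rw [mul_poisson_bound hm0, ← mul_assoc, mul_one_div_cancel hm0.ne', one_mul] at h4
  exact h4

/-- Bousquet's inequality for centered functions `g`, at most `1`, whose expected supremum is
controlled by the Rademacher average `R` and whose variances are at most `v`. -/
theorem sup_tail (hp : p ∈ stdSimplex ℝ Ω) {g : Ω → ι → ℝ} (hg : ∀ x a, g x a ≤ 1)
    (hmean : ∀ a, ∑ x, p x * g x a = 0) {v R : ℝ} (hvar : ∀ a, ∑ x, p x * g x a ^ 2 ≤ v)
    {m : ℕ} (hm : 1 ≤ m) (hR : pexp p m (fun x => ⨆ a, (∑ i, g (x i)) a) ≤ m * (2 * R)) {L : ℝ}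
    (hL : 0 < L) :
    pexp p m ({x | ∃ a, 2 * R + √(2 * L * (v + 4 * R) / m) + L / (3 * m) <
      1 / (m : ℝ) * ∑ i, g (x i) a}.indicator 1) ≤ Real.exp (-L) := by
  have hm0 : (0 : ℝ) < m := by exact_mod_cast hm
  set μ := pexp p m (fun x => ⨆ a, (∑ i, g (x i)) a) with hμ
  -- Needed for the variance factor `m v + 2μ` to be nonnegative. The supremum dominates a single
  -- sum, which is centered.
  have hμ0 : 0 ≤ μ := by
    have a := Classical.arbitrary ι
    have h0 : pexp p m (fun x => ∑ i, g (x i) a) = 0 := by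
      clear * - hmean hp
      induction m with
      | zero => simp [pexp_zero]
      | succ m ih =>
        rw [pexp_succ]
        simp only [Fin.sum_univ_succ, Fin.cons_zero, Fin.cons_succ]
        simp_rw [pexp_add, ih, pexp_const hp]
        simpa using hmean a
    rw [← h0]
    refine pexp_mono hp fun x => ?_
    have := le_ciSup (f := ∑ i, g (x i)) (Set.finite_range _).bddAbove a
    rwa [Finset.sum_apply] at this
  have hv0 : 0 ≤ v := le_trans (Finset.sum_nonneg fun x _ => mul_nonneg (hp.1 x) (sq_nonneg _))
    (hvar (Classical.arbitrary ι))
  have htail := bernstein_tail hp (m := m) (Z := fun x => ⨆ a, (∑ i, g (x i)) a) (μ := μ)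
    (v := m * v + 2 * μ) (by positivity) hL fun l hl => by
      have h := HasSubgradients.bousquet hp (HasSubgradients.iSup (ι := ι)) hg hmean hvar hl m 0
      have hφ : 0 ≤ l + 2 * (Real.exp l - l - 1) := by
        have := Real.add_one_le_exp l; linarith
      simp_rw [iSup_zero_add_smul hl.le, iSup_zero_add_smul hφ, pexp_const_mul] at h
      refine h.trans (le_of_eq ?_)
      congr 1
      ring
  refine (pexp_indicator_mono hp fun x hx => ?_).trans htail
  obtain ⟨a, ha⟩ := Set.mem_ofPred.1 hx
  have h1 := mul_lt_mul_of_pos_left ha hm0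
  rw [← mul_assoc (m : ℝ) (1 / m), mul_one_div_cancel hm0.ne', one_mul, mul_add, mul_add] at h1
  have h2 : m * √(2 * L * (v + 4 * R) / m) = √(2 * (m * v + m * (4 * R)) * L) := by
    rw [← Real.sqrt_sq hm0.le, ← Real.sqrt_mul (sq_nonneg _), Real.sqrt_sq hm0.le]
    congr 1
    field_simp
  have h3 : √(2 * (m * v + 2 * μ) * L) ≤ √(2 * (m * v + m * (4 * R)) * L) := by
    apply Real.sqrt_le_sqrt
    have : 2 * μ ≤ m * (4 * R) := by linarith
    gcongr
  have h4 : (m : ℝ) * (L / (3 * m)) = L / 3 := by field_simp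
  have h5 := le_ciSup (f := ∑ i, g (x i)) (Set.finite_range _).bddAbove a
  rw [Finset.sum_apply] at h5
  rw [h2, h4] at h1
  simp only [Set.mem_ofPred_eq]
  linarith

theorem sum_mul_sub_sq_le (hp : p ∈ stdSimplex ℝ Ω) (h : Ω → ℝ) :
    ∑ x, p x * (h x - ∑ y, p y * h y) ^ 2 ≤ ∑ x, p x * h x ^ 2 := by
  set e := ∑ y, p y * h y with he
  have : ∀ x, p x * (h x - e) ^ 2 = p x * h x ^ 2 - 2 * e * (p x * h x) + e ^ 2 * p x :=
    fun x => by ring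
  simp_rw [this]
  rw [Finset.sum_add_distrib, Finset.sum_sub_distrib, ← Finset.mul_sum, ← Finset.mul_sum, hp.2,
    ← he]
  nlinarith [sq_nonneg e]

/-- The supremum of the deviations of the averages `1 / m * ∑ i, f (x i) a` from their
expectations, in either direction (`s = 1` or `s = -1`). -/
theorem deviation_tail (hp : p ∈ stdSimplex ℝ Ω) {f : Ω → ι → ℝ}
    (hf : ∀ x a, f x a ∈ Set.Icc (0 : ℝ) 1) {m : ℕ} (hm : 1 ≤ m) {L : ℝ} (hL : 0 < L) (s : Bool) :
    pexp p m ({x | ∃ a, 2 * rademacher p f m +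
      √(2 * L * ((⨆ a, ∑ ω, p ω * f ω a ^ 2) + 4 * rademacher p f m) / m) + L / (3 * m) <
      sgn s * (∑ ω, p ω * f ω a - 1 / (m : ℝ) * ∑ i, f (x i) a)}.indicator 1) ≤
      Real.exp (-L) := by
  have hm0 : (0 : ℝ) < m := by exact_mod_cast hm
  have hs2 : sgn s * sgn s = 1 := by cases s <;> simp [sgn]
  set E : ι → ℝ := fun a => ∑ ω, p ω * f ω a with hE
  have hE0 (a) : 0 ≤ E a := Finset.sum_nonneg fun ω _ => mul_nonneg (hp.1 ω) (hf ω a).1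
  have hE1 (a) : E a ≤ 1 := by
    calc E a ≤ ∑ ω, p ω * 1 :=
          Finset.sum_le_sum fun ω _ => mul_le_mul_of_nonneg_left (hf ω a).2 (hp.1 ω)
      _ = 1 := by simp [hp.2]
  -- Both directions satisfy `g ≤ 1` because `f` and `E` lie in `[0, 1]`, and centering only
  -- decreases second moments, so the wimpy variance bounds the variances.
  set g : Ω → ι → ℝ := fun ω => sgn s • (E - f ω) with hg
  have hg1 (ω a) : g ω a ≤ 1 := by
    have h1 := hf ω a
    have h2 := hE0 a
    have h3 := hE1 a
    simp only [hg, Pi.smul_apply, Pi.sub_apply, smul_eq_mul]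
    cases s <;> simp only [sgn, Bool.false_eq_true, if_true, if_false] <;> linarith [h1.1, h1.2]
  have hmean (a) : ∑ ω, p ω * g ω a = 0 := by
    have : ∀ ω, p ω * g ω a = sgn s * (E a * p ω - p ω * f ω a) := fun ω => by
      simp [hg]; ring
    simp_rw [this]
    rw [← Finset.mul_sum, Finset.sum_sub_distrib, ← Finset.mul_sum, hp.2]
    simp [hE]
  have hvar (a) : ∑ ω, p ω * g ω a ^ 2 ≤ ⨆ a, ∑ ω, p ω * f ω a ^ 2 := by
    refine le_trans ?_ (le_ciSup (f := fun a => ∑ ω, p ω * f ω a ^ 2)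
      (Set.finite_range _).bddAbove a)
    refine le_trans (le_of_eq ?_) (sum_mul_sub_sq_le hp fun ω => f ω a)
    refine Finset.sum_congr rfl fun ω _ => ?_
    have : g ω a ^ 2 = sgn s * sgn s * (f ω a - E a) ^ 2 := by simp [hg]; ring
    rw [this, hs2, one_mul]
  have hsym : pexp p m (fun x => ⨆ a, (∑ i, g (x i)) a) ≤ m * (2 * rademacher p f m) := by
    have h := HasSubgradients.symmetrization hp (HasSubgradients.iSup (ι := ι))
      (fun ω => sgn s • f ω) m 0
    have e1 : ∑ y, p y • sgn s • f y = sgn s • E := by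
      ext a
      simp only [hE, Finset.sum_apply, Pi.smul_apply, smul_eq_mul, Finset.mul_sum]
      exact Finset.sum_congr rfl fun ω _ => by ring
    simp_rw [e1, ← smul_sub, zero_add] at h
    refine h.trans (le_of_eq ?_)
    rw [rademacher, mul_left_comm, ← pexp_const_mul, ← pexp_const_mul]
    congr 1
    ext x
    rw [mul_era f hm, ← pexp_const_mul]
    have e2 (ε : Fin m → Bool) : ⨆ a, ((2 : ℝ) • ∑ i, sgn (ε i) • sgn s • f (x i)) a =
        2 * ⨆ a, (∑ i, sgn (ε i) • sgn s • f (x i)) a := by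
      rw [← iSup_zero_add_smul zero_le_two, zero_add]
    simp_rw [e2]
    -- Reversing all signs preserves their law, so the Rademacher average does not depend on the
    -- direction `s`.
    cases s
    · rw [← rad_comp_not]
      have e3 : sgn false = -1 := rfl
      simp only [sgn_not, e3, neg_smul, smul_neg, one_smul, neg_neg]
    · simp [sgn]
  refine (pexp_indicator_mono hp fun x hx => ?_).trans
    (sup_tail hp hg1 hmean hvar hm hsym hL)
  obtain ⟨a, ha⟩ := Set.mem_ofPred.1 hx
  refine ⟨a, ha.trans_le (le_of_eq ?_)⟩
  have : ∑ i, g (x i) a = sgn s * (m * E a - ∑ i, f (x i) a) := by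
    simp only [hg, Pi.smul_apply, Pi.sub_apply, smul_eq_mul, ← Finset.mul_sum,
      Finset.sum_sub_distrib]
    simp
  rw [this]
  simp only [hE]
  field_simp

end Rademacher

/-! ### Sequences of independent samples from a finite space -/

theorem measurable_first {Ω : Type*} [MeasurableSpace Ω] (m : ℕ) :
    Measurable fun (ω : ℕ → Ω) (i : Fin m) => ω i := by
  fun_prop

section Sampling

variable {Ω : Type*} [Fintype Ω]

/-- The probabilities of a distribution on a finite space, as real numbers. -/
def weight (q : PMF Ω) (a : Ω) : ℝ := (q a).toReal

theorem weight_mem (q : PMF Ω) : weight q ∈ stdSimplex ℝ Ω := by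
  refine ⟨fun a => ENNReal.toReal_nonneg, ?_⟩
  unfold weight
  rw [← ENNReal.toReal_sum fun a _ => q.apply_ne_top a, ← tsum_fintype (L := .unconditional _),
    q.tsum_coe, ENNReal.toReal_one]

variable [MeasurableSpace Ω] [MeasurableSingletonClass Ω]

theorem measurableSet_first {m : ℕ} (A : Set (Fin m → Ω)) :
    MeasurableSet {ω : ℕ → Ω | (fun i : Fin m => ω i) ∈ A} :=
  measurable_first m (Set.toFinite A).measurableSet

/-- The bridge from the infinite sample to the finite weighted sums in which all tails are proved.
-/
theorem infinitePi_first (q : PMF Ω) {m : ℕ} (A : Set (Fin m → Ω)) :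
    (Measure.infinitePi fun _ : ℕ => q.toMeasure) {ω | (fun i : Fin m => ω i) ∈ A} =
      ENNReal.ofReal (pexp (weight q) m (A.indicator 1)) := by
  have hmap := Measure.map_infinitePi_infinitePi_of_inj (P := fun _ : ℕ => q.toMeasure)
    (f := fun i : Fin m => (i : ℕ)) Fin.val_injective
  have h1 : (Measure.infinitePi fun _ : ℕ => q.toMeasure) {ω | (fun i : Fin m => ω i) ∈ A} =
      (Measure.infinitePi fun _ : Fin m => q.toMeasure) A := by
    rw [← hmap, Measure.map_apply (measurable_first m) (Set.toFinite A).measurableSet]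
    rfl
  rw [h1, ← ofReal_measureReal]
  congr 1
  rw [← integral_indicator_one (Set.toFinite A).measurableSet,
    integral_fintype Integrable.of_finite]
  refine Finset.sum_congr rfl fun x _ => ?_
  rw [smul_eq_mul, measureReal_def, Measure.infinitePi_singleton_of_fintype, ENNReal.toReal_prod]
  congr 1
  refine Finset.prod_congr rfl fun i _ => ?_
  rw [q.toMeasure_apply_singleton _ (measurableSet_singleton _), weight]

end Sampling

theorem pexp_eval {Ω : Type*} [Fintype Ω] {p : Ω → ℝ} (hp : p ∈ stdSimplex ℝ Ω) {m : ℕ}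
    (l : Fin m) (g : Ω → ℝ) : pexp p m (fun x => g (x l)) = ∑ a, p a * g a := by
  induction m with
  | zero => exact l.elim0
  | succ m ih =>
    rw [pexp_succ]
    refine Fin.cases ?_ (fun l => ?_) l
    · simp only [Fin.cons_zero, pexp_const hp]
    · simp only [Fin.cons_succ, ih, ← Finset.sum_mul, hp.2, one_mul]

theorem bind_map_sigmaMk_apply {κ : Type*} {β : κ → Type*} (q : PMF κ) (r : ∀ e, PMF (β e)) (e : κ)
    (u : β e) : (q.bind fun e => (r e).map (Sigma.mk e)) ⟨e, u⟩ = q e * r e u := by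
  classical
  rw [PMF.bind_apply, tsum_eq_single e]
  · rw [PMF.map_apply, tsum_eq_single u]
    · simp
    · intro u' hu'
      rw [if_neg]
      intro heq
      exact hu' (eq_of_heq (Sigma.mk.inj heq).2).symm
  · intro e' he'
    rw [PMF.map_apply, ENNReal.tsum_eq_zero.2, mul_zero]
    intro u'
    rw [if_neg]
    intro heq
    exact he' (Sigma.mk.inj heq).1.symm

/-! ### The mean of the fraction of paths through a node -/

section Bags

variable {V : Type*} [Fintype V] {G : Digraph V} {α : ℝ}

instance : Fintype (Bag G α) :=
  inferInstanceAs (Fintype (Σ e : NodePair V, Fin (bagSize G α e) → ShortestPath G e.1.1 e.1.2))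

instance : DiscreteMeasurableSpace (Bag G α) := ⟨fun _ => trivial⟩

theorem bagFrac_mem_Icc (v : V) (τ : Bag G α) : bagFrac v τ ∈ Set.Icc (0 : ℝ) 1 := by
  classical
  unfold bagFrac
  constructor
  · exact div_nonneg (Finset.sum_nonneg fun x _ => by split_ifs <;> norm_num) (Nat.cast_nonneg _)
  · refine div_le_one_of_le₀ ?_ (Nat.cast_nonneg _)
    calc _ ≤ ∑ x : Fin (bagSize G α τ.1), (1 : ℝ) :=
          Finset.sum_le_sum fun x _ => by split_ifs <;> norm_num
      _ = _ := by simp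

theorem bagFrac_eq_zero {v : V} {τ : Bag G α} (h : ¬Observed v τ) : bagFrac v τ = 0 := by
  classical
  unfold bagFrac
  rw [Finset.sum_eq_zero, zero_div]
  intro x _
  exact if_neg fun hx => h ⟨x, hx⟩

theorem card_nodePair : (Fintype.card (NodePair V) : ℝ) =
    (Fintype.card V : ℝ) * ((Fintype.card V : ℝ) - 1) := by
  classical
  have h : Fintype.card (NodePair V) = (Finset.univ : Finset V).offDiag.card := by
    rw [Fintype.card_subtype]
    congr 1
    ext e
    simp
  rw [h, Finset.offDiag_card, Finset.card_univ, Nat.cast_sub (Nat.le_mul_self _)]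
  push_cast
  ring

/-- The bag made of the pair `e` and the paths `u`. -/
def mkBag (e : NodePair V) (u : Fin (bagSize G α e) → ShortestPath G e.1.1 e.1.2) : Bag G α :=
  ⟨e, u⟩

theorem sum_bag (F : Bag G α → ℝ) : ∑ τ, F τ = ∑ e, ∑ u, F (mkBag e u) :=
  Fintype.sum_sigma _

/-- The mean of `bagFrac v` over the bags of the pair `e`. -/
theorem sum_bagFrac_mkBag (hα : 1 ≤ α) (v : V) (e : NodePair V) :
    ∑ u, ((numPaths G e.1.1 e.1.2 : ℝ)⁻¹) ^ bagSize G α e *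
        bagFrac (G := G) (α := α) v (mkBag e u) =
      (numPathsThrough G e.1.1 e.1.2 v : ℝ) / (numPaths G e.1.1 e.1.2 : ℝ) := by
  classical
  rcases isEmpty_or_nonempty (ShortestPath G e.1.1 e.1.2) with hE | hN
  · have h0 : numPaths G e.1.1 e.1.2 = 0 := Fintype.card_eq_zero
    have h1 : bagSize G α e = 0 := by simp [bagSize, h0]
    rw [h0, Nat.cast_zero, div_zero]
    refine Finset.sum_eq_zero fun u _ => ?_
    rw [bagFrac_eq_zero, mul_zero]
    rintro ⟨x, -⟩
    exact (Fin.cast h1 x).elim0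
  · set N : ℝ := (numPaths G e.1.1 e.1.2 : ℝ) with hN
    have hNpos : 0 < N := by rw [hN]; exact_mod_cast Fintype.card_pos
    have hk : 0 < bagSize G α e := Nat.ceil_pos.2 (mul_pos (by linarith) hNpos)
    have hk' : (0 : ℝ) < bagSize G α e := by exact_mod_cast hk
    have hp : (fun _ => N⁻¹) ∈ stdSimplex ℝ (ShortestPath G e.1.1 e.1.2) := by
      refine ⟨fun _ => by positivity, ?_⟩
      rw [Finset.sum_const, nsmul_eq_mul, Finset.card_univ]
      exact mul_inv_cancel₀ hNpos.ne'
    set g : ShortestPath G e.1.1 e.1.2 → ℝ :=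
      fun q => if IsInternal e.1.1 e.1.2 v q.1 then 1 else 0 with hg
    have h1 : ∑ u, N⁻¹ ^ bagSize G α e * bagFrac (G := G) (α := α) v (mkBag e u) =
        pexp (fun _ => N⁻¹) (bagSize G α e)
          (fun u => (bagSize G α e : ℝ)⁻¹ * ∑ x, g (u x)) := by
      unfold pexp
      refine Finset.sum_congr rfl fun u _ => ?_
      rw [Finset.prod_const, Finset.card_univ, Fintype.card_fin]
      congr 1
      exact div_eq_inv_mul _ _
    rw [h1, pexp_const_mul, pexp_sum]
    simp_rw [pexp_eval hp]
    rw [Finset.sum_const, nsmul_eq_mul, Finset.card_univ, Fintype.card_fin, ← mul_assoc,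
      inv_mul_cancel₀ hk'.ne', one_mul, ← Finset.mul_sum, mul_comm, ← div_eq_mul_inv]
    congr 1
    rw [numPathsThrough, Nat.card_eq_fintype_card, Fintype.card_subtype, hg, Finset.sum_boole]

variable [Nontrivial V]

theorem bagPMF_mkBag (e : NodePair V)
    (u : Fin (bagSize G α e) → ShortestPath G e.1.1 e.1.2) :
    bagPMF G α (mkBag e u) = (Fintype.card (NodePair V) : ENNReal)⁻¹ *
      (Fintype.card (Fin (bagSize G α e) → ShortestPath G e.1.1 e.1.2) : ENNReal)⁻¹ := by
  classical
  refine (bind_map_sigmaMk_apply (PMF.uniformOfFintype (NodePair V))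
    (fun e => PMF.uniformOfFintype (Fin (bagSize G α e) → ShortestPath G e.1.1 e.1.2)) e u).trans ?_
  rw [PMF.uniformOfFintype_apply, PMF.uniformOfFintype_apply]

theorem weight_mkBag (e : NodePair V)
    (u : Fin (bagSize G α e) → ShortestPath G e.1.1 e.1.2) : weight (bagPMF G α) (mkBag e u) =
    (Fintype.card (NodePair V) : ℝ)⁻¹ * ((numPaths G e.1.1 e.1.2 : ℝ)⁻¹) ^ bagSize G α e := by
  rw [weight, bagPMF_mkBag, ENNReal.toReal_mul, ENNReal.toReal_inv, ENNReal.toReal_inv,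
    ENNReal.toReal_natCast, ENNReal.toReal_natCast, Fintype.card_fun, Fintype.card_fin,
    Nat.cast_pow, inv_pow]
  rfl

theorem sum_weight_mul_bagFrac (hα : 1 ≤ α) (v : V) :
    ∑ τ, weight (bagPMF G α) τ * bagFrac v τ = betweenness G v := by
  classical
  rw [sum_bag]
  have hpair (e : NodePair V) : ∑ u, weight (bagPMF G α) (mkBag e u) * bagFrac v (mkBag e u) =
      (Fintype.card (NodePair V) : ℝ)⁻¹ *
        ((numPathsThrough G e.1.1 e.1.2 v : ℝ) / (numPaths G e.1.1 e.1.2 : ℝ)) := by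
    rw [← sum_bagFrac_mkBag hα, Finset.mul_sum]
    exact Finset.sum_congr rfl fun u _ => by rw [weight_mkBag, mul_assoc]
  simp_rw [hpair]
  rw [← Finset.mul_sum, betweenness, card_nodePair, one_div]
  congr 1
  have hfil : ∑ e : NodePair V,
      ((numPathsThrough G e.1.1 e.1.2 v : ℝ) / (numPaths G e.1.1 e.1.2 : ℝ)) =
      ∑ e : V × V with e.1 ≠ e.2,
        (numPathsThrough G e.1 e.2 v : ℝ) / (numPaths G e.1 e.2 : ℝ) :=
    (Finset.sum_subtype _ (fun e => by simp)
      (fun e : V × V => (numPathsThrough G e.1 e.2 v : ℝ) / (numPaths G e.1 e.2 : ℝ))).symm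
  rw [hfil]
  symm
  -- The pairs left out in the betweenness are those with `v` as an endpoint; they contribute zero,
  -- since `v` is then never internal.
  refine Finset.sum_subset (fun e he => ?_) fun e he he' => ?_
  · simp only [Finset.mem_filter] at he ⊢
    exact ⟨he.1, he.2.1⟩
  · simp only [Finset.mem_filter, Finset.mem_univ, true_and] at he he'
    have h0 : numPathsThrough G e.1 e.2 v = 0 := by
      rw [numPathsThrough, Nat.card_eq_zero]
      refine Or.inl ⟨fun q => he' ⟨he, ?_⟩⟩
      exact ⟨q.2.2.1.symm, q.2.2.2.symm⟩
    rw [h0, Nat.cast_zero, zero_div]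

end Bags

/-! ### The `k`-th largest value -/

section KthLargest

variable {V : Type*} [Fintype V] {g b : V → ℝ} {k : ℕ}

theorem countP_sort_map (g : V → ℝ) (q : ℝ → Bool) :
    ((Finset.univ.val.map g).sort (· ≥ ·)).countP q =
      (Finset.univ.filter fun v => q (g v) = true).card := by
  have h : ((Finset.univ.val.map g).sort (· ≥ ·)).countP q =
      (Finset.univ.val.map g).countP fun x => q x = true := by
    conv_rhs => rw [← Multiset.sort_eq (Finset.univ.val.map g) (· ≥ ·)]
    rw [Multiset.coe_countP]
    simp
  rw [h, Multiset.countP_map]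
  rfl

theorem kthLargest_eq (hk : 1 ≤ k) (hkn : k ≤ Fintype.card V) :
    ∃ h : k - 1 < ((Finset.univ.val.map g).sort (· ≥ ·)).length,
      kthLargest g k = ((Finset.univ.val.map g).sort (· ≥ ·))[k - 1] := by
  have h : k - 1 < ((Finset.univ.val.map g).sort (· ≥ ·)).length := by
    simp only [Multiset.length_sort, Multiset.card_map, Finset.card_val, Finset.card_univ]
    omega
  exact ⟨h, List.getD_eq_getElem _ _ h⟩

/-- Otherwise all entries of the decreasing list from position `k - 1` on are below `x`, leaving at
most `k - 1` entries that reach it. -/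
theorem le_kthLargest (hk : 1 ≤ k) (hkn : k ≤ Fintype.card V) {x : ℝ}
    (h : k ≤ (Finset.univ.filter fun v => x ≤ g v).card) : x ≤ kthLargest g k := by
  obtain ⟨hlt, he⟩ := kthLargest_eq (g := g) hk hkn
  rw [he]
  by_contra! hx
  have hs := (Multiset.pairwise_sort (Finset.univ.val.map g) (· ≥ ·))
  have hc := countP_sort_map g fun y => decide (x ≤ y)
  simp only [decide_eq_true_eq] at hc
  rw [← hc] at h
  set l := (Finset.univ.val.map g).sort (· ≥ ·)
  rw [← List.take_append_drop (k - 1) l, List.countP_append] at h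
  have h1 : (l.take (k - 1)).countP (fun y => decide (x ≤ y)) ≤ k - 1 :=
    List.countP_le_length.trans (List.length_take_le _ _)
  have h2 : (l.drop (k - 1)).countP (fun y => decide (x ≤ y)) = 0 := by
    rw [List.countP_eq_zero]
    intro y hy
    obtain ⟨i, hi, rfl⟩ := List.mem_drop_iff_getElem.1 hy
    simp only [decide_eq_true_eq, not_le]
    refine lt_of_le_of_lt ?_ hx
    rcases Nat.eq_zero_or_pos i with rfl | hi0
    · exact le_rfl
    · exact List.pairwise_iff_getElem.1 hs _ _ _ _ (by omega)
  omega

theorem card_kthLargest_le (hk : 1 ≤ k) (hkn : k ≤ Fintype.card V) :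
    k ≤ (Finset.univ.filter fun v => kthLargest g k ≤ g v).card := by
  obtain ⟨hlt, he⟩ := kthLargest_eq (g := g) hk hkn
  have hs := (Multiset.pairwise_sort (Finset.univ.val.map g) (· ≥ ·))
  have hc := countP_sort_map g fun y => decide (kthLargest g k ≤ y)
  simp only [decide_eq_true_eq] at hc
  rw [← hc]
  set l := (Finset.univ.val.map g).sort (· ≥ ·)
  rw [← List.take_append_drop k l, List.countP_append]
  have h1 : (l.take k).countP (fun y => decide (kthLargest g k ≤ y)) = (l.take k).length := by
    rw [List.countP_eq_length]
    intro y hy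
    obtain ⟨i, hi, rfl⟩ := List.mem_take_iff_getElem.1 hy
    rw [decide_eq_true_eq, he]
    rcases eq_or_ne i (k - 1) with rfl | hne
    · exact le_rfl
    · exact List.pairwise_iff_getElem.1 hs _ _ _ _ (by omega)
  rw [List.length_take] at h1
  omega

variable (v : Fin (Fintype.card V) ≃ V)

theorem le_kthLargest_of_forall (hk : 1 ≤ k) (hkn : k ≤ Fintype.card V) {x : ℝ}
    (h : ∀ i : Fin (Fintype.card V), i.1 < k → x ≤ g (v i)) : x ≤ kthLargest g k := by
  classical
  refine le_kthLargest hk hkn ?_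
  calc k = ((Finset.univ.filter fun i : Fin (Fintype.card V) => i.1 < k).map
        v.toEmbedding).card := by
        rw [Finset.card_map, Fin.card_filter_val_lt, min_eq_right hkn]
    _ ≤ _ := by
        refine Finset.card_le_card fun u hu => ?_
        simp only [Finset.mem_map, Finset.mem_filter, Finset.mem_univ, true_and] at hu ⊢
        obtain ⟨i, hi, rfl⟩ := hu
        exact h i hi

/-- At least `k` nodes reach the `k`-th largest value of `g`, so one of them is not among the first
`k - 1` of the order `v`; its `b` is at most `b(v_k)` and at least its `g`. -/
theorem kthLargest_le (hk : 1 ≤ k) (hkn : k ≤ Fintype.card V) (hv : Antitone fun i => b (v i))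
    (h : ∀ u, g u ≤ b u) : kthLargest g k ≤ b (v ⟨k - 1, by omega⟩) := by
  classical
  obtain ⟨u, hu, hu'⟩ : ∃ u, kthLargest g k ≤ g u ∧ k - 1 ≤ (v.symm u).1 := by
    by_contra! hcon
    have := card_kthLargest_le (g := g) hk hkn
    have hle : (Finset.univ.filter fun u => kthLargest g k ≤ g u).card ≤
        ((Finset.univ.filter fun i : Fin (Fintype.card V) => i.1 < k - 1).map
          v.toEmbedding).card := by
      refine Finset.card_le_card fun u hu => ?_
      simp only [Finset.mem_map, Finset.mem_filter, Finset.mem_univ, true_and] at hu ⊢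
      exact ⟨v.symm u, hcon u hu, by simp⟩
    rw [Finset.card_map, Fin.card_filter_val_lt] at hle
    omega
  refine hu.trans ((h u).trans ?_)
  have := hv (a := ⟨k - 1, by omega⟩) (b := v.symm u) hu'
  simpa using this

end KthLargest

/-! ### Correctness of the output -/

section Correctness

variable {V : Type*} [Fintype V] {G : Digraph V} {α : ℝ} {P : Params G α}
  {S' : List (Bag G α)} {S : ℕ → Bag G α} {σ : ℕ → Fin P.c → Bool} {i : ℕ}

theorem estimate_mem_Icc (S : ℕ → Bag G α) (m : ℕ) (u : V) :
    estimate S m u ∈ Set.Icc (0 : ℝ) 1 := by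
  unfold estimate
  refine ⟨mul_nonneg (by positivity) (Finset.sum_nonneg fun i _ => (bagFrac_mem_Icc u _).1), ?_⟩
  rw [one_div_mul_eq_div]
  refine div_le_one_of_le₀ ?_ (Nat.cast_nonneg _)
  calc _ ≤ ∑ _i ∈ Finset.range m, (1 : ℝ) := Finset.sum_le_sum fun i _ => (bagFrac_mem_Icc u _).2
    _ = m := by simp

theorem isRelativeApprox_topTilde (hk : 1 ≤ P.k) (hkn : P.k ≤ Fintype.card V)
    (hη : P.η ∈ Set.Ioo (0 : ℝ) 1) (v : Fin (Fintype.card V) ≃ V) {b : V → ℝ}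
    (hv : Antitone fun i => b (v i))
    (hgood : ∀ u, |b u - bTilde P S' S i u| ≤ width P S' S σ i u)
    (hterm : StopTopk P S' S σ i) :
    IsRelativeApprox b v P.k hk hkn P.η (topTilde P S' S σ i) := by
  obtain ⟨hη0, hη1⟩ := hη
  have hp : 0 < 1 + P.η := by linarith
  have hn : 0 < 1 - P.η := by linarith
  have hlow (u) : lower P S' S σ i u ≤ b u := by
    have := (abs_le.1 (hgood u)).1
    unfold lower
    linarith
  have hupp (u) : b u ≤ upper P S' S σ i u := by
    have := (abs_le.1 (hgood u)).2
    unfold upper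
    linarith
  have hkth := kthLargest_le (g := lower P S' S σ i) v hk hkn hv hlow
  have htop (j : Fin (Fintype.card V)) (hj : j.1 < P.k) : v j ∈ topNodes P S' S σ i := by
    refine hkth.trans (le_trans ?_ (hupp (v j)))
    exact hv (a := j) (b := ⟨P.k - 1, by omega⟩) (Fin.mk_le_mk.2 (by omega))
  -- The two halves of the stopping rule combine to bound `ℓ / u` independently of the estimate.
  have hratio (u) (hu : u ∈ topNodes P S' S σ i) :
      upper P S' S σ i u * ((1 - P.η) / (1 + P.η)) ≤ lower P S' S σ i u := by
    obtain ⟨h1, h2⟩ := hterm u hu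
    rw [le_div_iff₀ hn] at h2
    refine le_trans ?_ h1
    rw [← mul_div_assoc]
    exact div_le_div_of_nonneg_right h2 hp.le
  have hq : 0 ≤ (1 - P.η) / (1 + P.η) := by positivity
  -- First use of the ratio: all top nodes are selected, so their lower ends bound `ℓ_k` from below.
  -- The second use is on a node with `u(v) ≥ ℓ_k`.
  have hk2 : b (v ⟨P.k - 1, by omega⟩) * ((1 - P.η) / (1 + P.η)) ≤
      kthLargest (lower P S' S σ i) P.k := by
    refine le_kthLargest_of_forall v hk hkn fun j hj => ?_
    refine le_trans ?_ (hratio _ (htop j hj))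
    refine mul_le_mul_of_nonneg_right (le_trans ?_ (hupp (v j))) hq
    exact hv (a := j) (b := ⟨P.k - 1, by omega⟩) (Fin.mk_le_mk.2 (by omega))
  refine ⟨?_, ?_, ?_, ?_, ?_⟩
  · rintro _ ⟨u, -, rfl⟩ _ ⟨u', -, rfl⟩ h
    obtain rfl : u = u' := h
    rfl
  · rintro _ ⟨u, -, rfl⟩
    exact estimate_mem_Icc _ _ _
  · exact fun j hj => ⟨_, v j, htop j hj, rfl⟩
  · rintro _ ⟨u, hu, rfl⟩
    obtain ⟨h1, h2⟩ := hterm u hu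
    have h1 := h1.trans (hlow u)
    have h2 := (hupp u).trans h2
    rw [div_le_iff₀ hp] at h1
    rw [le_div_iff₀ hn] at h2
    simp only
    rw [abs_le]
    constructor <;> linarith
  · rintro _ ⟨u, hu, rfl⟩ -
    rw [sq, ← mul_assoc]
    calc _ ≤ kthLargest (lower P S' S σ i) P.k * ((1 - P.η) / (1 + P.η)) :=
          mul_le_mul_of_nonneg_right hk2 hq
      _ ≤ upper P S' S σ i u * ((1 - P.η) / (1 + P.η)) := mul_le_mul_of_nonneg_right hu hq
      _ ≤ lower P S' S σ i u := hratio u hu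
      _ ≤ b u := hlow u

end Correctness

/-! ### The probability of a large deviation -/

section Product

variable {Ω Ω' : Type*} [Fintype Ω] [MeasurableSpace Ω] [MeasurableSingletonClass Ω]
  [MeasurableSpace Ω']

theorem prod_infinitePi_left_le (q : PMF Ω) (q' : PMF Ω') {m : ℕ} {A : Set (Fin m → Ω)} {r : ℝ}
    (h : pexp (weight q) m (A.indicator 1) ≤ r) :
    ((Measure.infinitePi fun _ : ℕ => q.toMeasure).prod
      (Measure.infinitePi fun _ : ℕ => q'.toMeasure)) {ω | (fun i : Fin m => ω.1 i) ∈ A} ≤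
      ENNReal.ofReal r := by
  have e : {ω : (ℕ → Ω) × (ℕ → Ω') | (fun i : Fin m => ω.1 i) ∈ A} =
      {ω : ℕ → Ω | (fun i : Fin m => ω i) ∈ A} ×ˢ Set.univ := by
    ext ω; simp
  rw [e, Measure.prod_prod, measure_univ, mul_one, infinitePi_first]
  exact ENNReal.ofReal_le_ofReal h

variable [Fintype Ω'] [MeasurableSingletonClass Ω']

/-- Conditioning on the bags: the tail of `mcera_tail` is uniform in the sample. -/
theorem prod_infinitePi_le (q : PMF Ω) (q' : PMF Ω') {m : ℕ} {A : Set ((Fin m → Ω) × (Fin m → Ω'))}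
    {r : ℝ} (h : ∀ x, pexp (weight q') m ({y | (x, y) ∈ A}.indicator 1) ≤ r) :
    ((Measure.infinitePi fun _ : ℕ => q.toMeasure).prod
      (Measure.infinitePi fun _ : ℕ => q'.toMeasure))
        {ω | ((fun i : Fin m => ω.1 i), (fun i : Fin m => ω.2 i)) ∈ A} ≤ ENNReal.ofReal r := by
  have hA : MeasurableSet {ω : (ℕ → Ω) × (ℕ → Ω') |
      ((fun i : Fin m => ω.1 i), (fun i : Fin m => ω.2 i)) ∈ A} :=
    (((measurable_first m).comp measurable_fst).prodMk ((measurable_first m).comp measurable_snd))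
      (Set.toFinite A).measurableSet
  rw [Measure.prod_apply hA]
  calc _ ≤ ∫⁻ _, ENNReal.ofReal r ∂(Measure.infinitePi fun _ : ℕ => q.toMeasure) := by
        refine lintegral_mono fun S => ?_
        exact (infinitePi_first q' {y | ((fun i : Fin m => S i), y) ∈ A}).le.trans
          (ENNReal.ofReal_le_ofReal (h _))
    _ = _ := by simp

end Product

theorem weight_uniform_signs (c : ℕ) :
    weight (PMF.uniformOfFintype (Fin c → Bool)) = signsWeight c := by
  ext x
  simp [weight, signsWeight]

/-- The bound is increasing in the Rademacher average and in the variance, so unknown quantities may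
be replaced by their upper estimates. -/
theorem abs_le_epsBound {Δ era rad mc w vt L : ℝ} {c m : ℕ} (hL : 0 < L)
    (h1 : era ≤ mc + √(4 * w * L / (c * m)))
    (h2 : rad ≤ era + L / m + √((L / m) ^ 2 + 2 * L * era / m)) (h3 : vt ≤ varBound w L m)
    (h4 : ∀ s, sgn s * Δ ≤ 2 * rad + √(2 * L * (vt + 4 * rad) / m) + L / (3 * m)) :
    |Δ| ≤ epsBound mc w (varBound w L m) L c m := by
  have hR : rad ≤ mc + √(4 * w * L / (c * m)) + L / m +
      √((L / m) ^ 2 + 2 * L * (mc + √(4 * w * L / (c * m))) / m) := by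
    refine h2.trans ?_
    gcongr
  have h : 2 * rad + √(2 * L * (vt + 4 * rad) / m) + L / (3 * m) ≤
      epsBound mc w (varBound w L m) L c m := by
    simp only [epsBound]
    gcongr
  rw [abs_le']
  have ht := h4 true
  have hf := h4 false
  simp only [sgn, Bool.false_eq_true, if_true, if_false, one_mul, neg_mul] at ht hf
  exact ⟨ht.trans h, hf.trans h⟩

section Deviation

variable {V : Type*} [Fintype V] {G : Digraph V} {α : ℝ}

/-- The law of the bags and of the signs of the second phase. -/
abbrev secondLaw [Nontrivial V] (G : Digraph V) (α : ℝ) (c : ℕ) :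
    Measure ((ℕ → Bag G α) × (ℕ → Fin c → Bool)) :=
  (Measure.infinitePi fun _ : ℕ => (bagPMF G α).toMeasure).prod
    (Measure.infinitePi fun _ : ℕ => (PMF.uniformOfFintype (Fin c → Bool)).toMeasure)

/-- Outside five events of probability at most `exp (-L)` each, `abs_le_epsBound` applies to every
node of the class. The factor `5` in the logarithm pays for this union bound. An empty class has no
node to miss, and has to be set aside because the tail bounds need a nonempty index set. -/
theorem measure_epsClass_lt [Nontrivial V] (hα : 1 ≤ α) {c t m : ℕ} (hc : 1 ≤ c) (hm : 1 ≤ m)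
    {δ : ℝ} (hδ : δ ∈ Set.Ioo (0 : ℝ) 1) (lab : V → Fin t) (i : ℕ) (j : Fin t) :
    secondLaw G α c {ω | ∃ u, lab u = j ∧
      epsClass δ ω.1 ω.2 m lab i j < |betweenness G u - estimate ω.1 m u|} ≤
      ENNReal.ofReal (δ / (t * 2 ^ i)) := by
  rcases isEmpty_or_nonempty {u : V // lab u = j} with hE | hN
  · have : {ω : (ℕ → Bag G α) × (ℕ → Fin c → Bool) | ∃ u, lab u = j ∧
      epsClass δ ω.1 ω.2 m lab i j < |betweenness G u - estimate ω.1 m u|} = ∅ := by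
      ext ω
      simp only [Set.mem_ofPred_eq, Set.mem_empty_iff_false, iff_false]
      rintro ⟨u, hu, -⟩
      exact hE.false ⟨u, hu⟩
    rw [this, measure_empty]
    exact zero_le
  classical
  have ht : 1 ≤ t := Nat.one_le_of_lt j.2
  have ht' : (1 : ℝ) ≤ t := by exact_mod_cast ht
  set L := Real.log (5 * t * 2 ^ i / δ) with hLdef
  have hx : 1 < 5 * t * 2 ^ i / δ := by
    rw [one_lt_div hδ.1]
    have : (1 : ℝ) ≤ 2 ^ i := one_le_pow₀ one_le_two
    nlinarith [hδ.2]
  have hL : 0 < L := Real.log_pos hx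
  have hexp : Real.exp (-L) = δ / (5 * t * 2 ^ i) := by
    rw [hLdef, Real.exp_neg, Real.exp_log (by linarith), inv_div]
  have hp : weight (bagPMF G α) ∈ stdSimplex ℝ (Bag G α) := weight_mem _
  set f : Bag G α → {u : V // lab u = j} → ℝ := fun τ u => bagFrac u.1 τ with hfdef
  have hf : ∀ τ u, f τ u ∈ Set.Icc (0 : ℝ) 1 := fun τ u => bagFrac_mem_Icc _ _
  set R := rademacher (weight (bagPMF G α)) f m with hR
  set vt := ⨆ u, ∑ τ, weight (bagPMF G α) τ * f τ u ^ 2 with hvt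
  set w : (Fin m → Bag G α) → ℝ := fun x => ⨆ u, 1 / (m : ℝ) * ∑ i, f (x i) u ^ 2 with hw
  set A1 : Set ((Fin m → Bag G α) × (Fin m → Fin c → Bool)) :=
    {z | 1 / (c : ℝ) * (∑ y : Fin c, ⨆ u, 1 / (m : ℝ) * ∑ i, sgn (z.2 i y) * f (z.1 i) u) +
      √(4 * w z.1 * L / (c * m)) < era f z.1} with hA1
  set A2 : Set (Fin m → Bag G α) :=
    {x | era f x + L / m + √((L / m) ^ 2 + 2 * L * era f x / m) < R} with hA2
  set A3 : Set (Fin m → Bag G α) := {x | varBound (w x) L m < vt} with hA3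
  set A4 : Bool → Set (Fin m → Bag G α) := fun s =>
    {x | ∃ u, 2 * R + √(2 * L * (vt + 4 * R) / m) + L / (3 * m) <
      sgn s * (∑ τ, weight (bagPMF G α) τ * f τ u - 1 / (m : ℝ) * ∑ i, f (x i) u)} with hA4
  have hsub : {ω : (ℕ → Bag G α) × (ℕ → Fin c → Bool) | ∃ u, lab u = j ∧
      epsClass δ ω.1 ω.2 m lab i j < |betweenness G u - estimate ω.1 m u|} ⊆
      {ω | ((fun i : Fin m => ω.1 i), (fun i : Fin m => ω.2 i)) ∈ A1} ∪
      ({ω | (fun i : Fin m => ω.1 i) ∈ A2} ∪ ({ω | (fun i : Fin m => ω.1 i) ∈ A3} ∪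
      ({ω | (fun i : Fin m => ω.1 i) ∈ A4 true} ∪ {ω | (fun i : Fin m => ω.1 i) ∈ A4 false}))) := by
    rintro ⟨S, σ⟩ ⟨u, hu, hlt⟩
    by_contra hcon
    simp only [Set.mem_union, not_or] at hcon
    obtain ⟨h1, h2, h3, h4, h5⟩ := hcon
    refine absurd hlt (not_lt.2 ?_)
    have hest : estimate S m u = 1 / (m : ℝ) * ∑ i : Fin m, f (S i) ⟨u, hu⟩ := by
      rw [estimate, Finset.sum_range]
    have hmean : betweenness G u = ∑ τ, weight (bagPMF G α) τ * f τ ⟨u, hu⟩ :=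
      (sum_weight_mul_bagFrac hα u).symm
    have hmc : mcera S σ m lab j = 1 / (c : ℝ) * (∑ y : Fin c, ⨆ u : {u : V // lab u = j},
        1 / (m : ℝ) * ∑ i : Fin m, sgn (σ i y) * f (S i) u) := by
      rw [mcera]
      simp_rw [Finset.sum_range]
      rfl
    have hwv : wimpyVar S m lab j = w fun i => S i := by
      rw [wimpyVar]
      simp_rw [Finset.sum_range]
      rfl
    have hle := abs_le_epsBound (Δ := betweenness G u - estimate S m u)
      (era := era f fun i : Fin m => S i) (rad := R) (mc := mcera S σ m lab j)
      (w := wimpyVar S m lab j) (vt := vt) (L := L) (c := c) (m := m) hL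
      (by rw [hmc, hwv]; exact not_lt.1 h1) (not_lt.1 h2) (by rw [hwv]; exact not_lt.1 h3)
      (by
        rw [hest, hmean]
        rintro (_ | _)
        · exact not_lt.1 fun hx => h5 ⟨_, hx⟩
        · exact not_lt.1 fun hx => h4 ⟨_, hx⟩)
    exact hle
  have hsum : ENNReal.ofReal (δ / (t * 2 ^ i)) = ENNReal.ofReal (Real.exp (-L)) +
      (ENNReal.ofReal (Real.exp (-L)) + (ENNReal.ofReal (Real.exp (-L)) +
      (ENNReal.ofReal (Real.exp (-L)) + ENNReal.ofReal (Real.exp (-L))))) := by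
    have h0 := (Real.exp_pos (-L)).le
    rw [← ENNReal.ofReal_add (by positivity) (by positivity),
      ← ENNReal.ofReal_add (by positivity) (by positivity),
      ← ENNReal.ofReal_add (by positivity) (by positivity),
      ← ENNReal.ofReal_add (by positivity) (by positivity), hexp]
    congr 1
    field_simp
    norm_num
  rw [hsum]
  refine (measure_mono hsub).trans ((measure_union_le _ _).trans (add_le_add ?_
    ((measure_union_le _ _).trans (add_le_add ?_ ((measure_union_le _ _).trans (add_le_add ?_
    ((measure_union_le _ _).trans (add_le_add ?_ ?_))))))))
  · refine prod_infinitePi_le _ _ fun x => ?_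
    rw [weight_uniform_signs]
    exact mcera_tail f hm hc x hL
  · exact prod_infinitePi_left_le _ _ (era_tail hp hf hm hL)
  · exact prod_infinitePi_left_le _ _ (wimpy_tail hp hf hm hL)
  · exact prod_infinitePi_left_le _ _ (deviation_tail hp hf hm hL true)
  · exact prod_infinitePi_left_le _ _ (deviation_tail hp hf hm hL false)

variable (P : Params G α)

/-- The event that, for some iteration, some confidence interval misses the betweenness. -/
def missEvent (S' : List (Bag G α)) : Set ((ℕ → Bag G α) × (ℕ → Fin P.c → Bool)) :=
  {ω | ∃ i, 1 ≤ i ∧ ∃ u, width P S' ω.1 ω.2 i u < |betweenness G u - bTilde P S' ω.1 i u|}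

/-- The `t` classes share `δ / 2^i` at iteration `i`, and these sum to `δ` over `i ≥ 1`. -/
theorem measure_missEvent_le [Nontrivial V] (hα : 1 ≤ α) (hc : 1 ≤ P.c)
    (hδ : P.δ ∈ Set.Ioo (0 : ℝ) 1)
    {S' : List (Bag G α)} (h1 : 1 ≤ P.sched S' 1) (hmono : Monotone (P.sched S')) :
    secondLaw G α P.c (missEvent P S') ≤ ENNReal.ofReal P.δ := by
  set t := (P.peel S').1 with ht
  have htpos : 0 < t := by
    obtain ⟨u⟩ : Nonempty V := inferInstance
    exact Nat.zero_lt_of_lt ((P.peel S').2 u).2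
  have ht0 : (0 : ℝ) < t := by exact_mod_cast htpos
  have hsub : missEvent P S' ⊆ ⋃ i : ℕ, ⋃ j : Fin t, {ω | ∃ u, (P.peel S').2 u = j ∧
      epsClass P.δ ω.1 ω.2 (P.sched S' (i + 1)) (P.peel S').2 (i + 1) j <
        |betweenness G u - estimate ω.1 (P.sched S' (i + 1)) u|} := by
    rintro ω ⟨i, hi, u, hu⟩
    obtain ⟨i, rfl⟩ : ∃ i', i = i' + 1 := ⟨i - 1, by omega⟩
    exact Set.mem_iUnion.2 ⟨i, Set.mem_iUnion.2 ⟨(P.peel S').2 u, u, rfl, hu⟩⟩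
  refine (measure_mono hsub).trans ((measure_iUnion_le _).trans ?_)
  calc _ ≤ ∑' i : ℕ, ENNReal.ofReal (P.δ / 2 / 2 ^ i) := by
        refine ENNReal.tsum_le_tsum fun i => ?_
        refine (measure_iUnion_fintype_le _ _).trans ?_
        refine (Finset.sum_le_sum fun j _ => measure_epsClass_lt hα hc
          (h1.trans (hmono (by omega))) hδ (P.peel S').2 (i + 1) j).trans ?_
        rw [Finset.sum_const, Finset.card_univ, Fintype.card_fin, nsmul_eq_mul,
          ← ENNReal.ofReal_natCast, ← ENNReal.ofReal_mul (Nat.cast_nonneg _)]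
        refine ENNReal.ofReal_le_ofReal (le_of_eq ?_)
        change (t : ℝ) * (P.δ / (t * 2 ^ (i + 1))) = _
        rw [pow_succ]
        field_simp
    _ = ENNReal.ofReal (∑' i : ℕ, P.δ / 2 / 2 ^ i) :=
        (ENNReal.ofReal_tsum_of_nonneg (fun i => by have := hδ.1; positivity)
          (summable_geometric_two' P.δ)).symm
    _ = ENNReal.ofReal P.δ := by rw [tsum_geometric_two']

theorem measurableSet_missEvent (S' : List (Bag G α)) : MeasurableSet (missEvent P S') := by
  have hb (u : V) (i : ℕ) : Measurable fun S : ℕ → Bag G α => bagFrac u (S i) :=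
    (Measurable.of_discrete (f := bagFrac u)).comp (measurable_pi_apply i)
  have hs (i : ℕ) (x : Fin P.c) : Measurable fun σ : ℕ → Fin P.c → Bool => sgn (σ i x) :=
    (Measurable.of_discrete (f := fun y : Fin P.c → Bool => sgn (y x))).comp (measurable_pi_apply i)
  have hest (i : ℕ) (u : V) : Measurable fun ω : (ℕ → Bag G α) × (ℕ → Fin P.c → Bool) =>
      bTilde P S' ω.1 i u := by
    unfold bTilde estimate
    exact (Finset.measurable_sum _ fun i _ => (hb u i).comp measurable_fst).const_mul _
  have hmc (m : ℕ) {t : ℕ} (lab : V → Fin t) (j : Fin t) :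
      Measurable fun ω : (ℕ → Bag G α) × (ℕ → Fin P.c → Bool) => mcera ω.1 ω.2 m lab j := by
    unfold mcera
    refine (Finset.measurable_sum _ fun x _ => Measurable.iSup fun u => ?_).const_mul _
    exact (Finset.measurable_sum _ fun i _ => ((hs i x).comp measurable_snd).mul
      ((hb u.1 i).comp measurable_fst)).const_mul _
  have hw (m : ℕ) {t : ℕ} (lab : V → Fin t) (j : Fin t) :
      Measurable fun ω : (ℕ → Bag G α) × (ℕ → Fin P.c → Bool) => wimpyVar ω.1 m lab j := by
    unfold wimpyVar
    refine Measurable.iSup fun u => ?_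
    exact (Finset.measurable_sum _ fun i _ =>
      ((hb u.1 i).comp measurable_fst).pow_const 2).const_mul _
  have hwidth (i : ℕ) (u : V) : Measurable fun ω : (ℕ → Bag G α) × (ℕ → Fin P.c → Bool) =>
      width P S' ω.1 ω.2 i u := by
    have h1 := hmc (P.sched S' i) (P.peel S').2 ((P.peel S').2 u)
    have h2 := hw (P.sched S' i) (P.peel S').2 ((P.peel S').2 u)
    unfold width epsClass
    simp only [epsBound, varBound]
    fun_prop
  have e : missEvent P S' = ⋃ i : ℕ, ⋃ _ : 1 ≤ i, ⋃ u : V,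
      {ω | width P S' ω.1 ω.2 i u < |betweenness G u - bTilde P S' ω.1 i u|} := by
    ext ω
    simp [missEvent]
  rw [e]
  refine MeasurableSet.iUnion fun i => MeasurableSet.iUnion fun _ => MeasurableSet.iUnion fun u => ?_
  exact measurableSet_lt (hwidth i u) (measurable_const.sub (hest i u)).abs

/-- The first phase stops after `n` bags. -/
def StopsAt (S : ℕ → Bag G α) (n : ℕ) : Prop :=
  StopFirst P (firstBags S n) ∧ ∀ k < n, ¬StopFirst P (firstBags S k)

theorem measurableSet_firstBags (n : ℕ) (Q : List (Bag G α) → Prop) :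
    MeasurableSet {S : ℕ → Bag G α | Q (firstBags S n)} := by
  have e (S : ℕ → Bag G α) : firstBags S n = List.ofFn fun i : Fin n => S i := by
    rw [firstBags, List.ofFn_eq_map, ← List.map_coe_finRange_eq_range, List.map_map]
    rfl
  simp_rw [e]
  exact measurableSet_first {x : Fin n → Bag G α | Q (List.ofFn x)}

/-- The event that the first phase stops and some confidence interval of the second phase misses
the betweenness. -/
def badEvent : Set (Sample G α P.c) :=
  {ω | ∃ n, StopsAt P ω.1 n ∧ ω.2 ∈ missEvent P (firstBags ω.1 n)}

theorem measurableSet_badEvent : MeasurableSet (badEvent P) := by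
  -- The rules `peel` and `sched` are arbitrary, but the first phase has only countably many
  -- outcomes; on each of them the event is a rectangle.
  have e : badEvent P = ⋃ n : ℕ, ⋃ l : List (Bag G α),
      ({S | StopsAt P S n} ∩ {S | firstBags S n = l}) ×ˢ missEvent P l := by
    ext ω
    simp only [badEvent, Set.mem_ofPred_eq, Set.mem_iUnion, Set.mem_prod, Set.mem_inter_iff]
    constructor
    · rintro ⟨n, h1, h2⟩
      exact ⟨n, _, ⟨h1, rfl⟩, h2⟩
    · rintro ⟨n, l, ⟨h1, rfl⟩, h2⟩
      exact ⟨n, h1, h2⟩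
  rw [e]
  have : Countable (List (Bag G α)) := inferInstance
  refine MeasurableSet.iUnion fun n => MeasurableSet.iUnion fun l => ?_
  refine MeasurableSet.prod (MeasurableSet.inter ?_ (measurableSet_firstBags n fun x => x = l))
    (measurableSet_missEvent P l)
  have e2 : {S : ℕ → Bag G α | StopsAt P S n} = {S | StopFirst P (firstBags S n)} ∩
      ⋂ k : ℕ, ⋂ _ : k < n, {S | ¬StopFirst P (firstBags S k)} := by
    ext S
    simp [StopsAt]
  rw [e2]
  exact (measurableSet_firstBags n _).inter (MeasurableSet.iInter fun k =>
    MeasurableSet.iInter fun _ => measurableSet_firstBags k fun x => ¬StopFirst P x)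

/-- Given the bags of the first phase, the stopping time is unique and the section of the event is a
single `missEvent`, with fixed classes and schedule, or is empty. -/
theorem measure_badEvent_le [Nontrivial V] (hα : 1 ≤ α) (hc : 1 ≤ P.c)
    (hδ : P.δ ∈ Set.Ioo (0 : ℝ) 1)
    (hsched : ∀ S', P.sched S' 0 = 0 ∧ 1 ≤ P.sched S' 1 ∧ Monotone (P.sched S')) :
    sampleLaw G α P.c (badEvent P) ≤ ENNReal.ofReal P.δ := by
  unfold sampleLaw
  rw [Measure.prod_apply (measurableSet_badEvent P)]
  calc _ ≤ ∫⁻ _, ENNReal.ofReal P.δ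
        ∂(Measure.infinitePi fun _ : ℕ => (bagPMF G α).toMeasure) := by
        refine lintegral_mono fun S => ?_
        by_cases h : ∃ n, StopsAt P S n
        · obtain ⟨n, hn⟩ := h
          refine le_trans (measure_mono ?_) (measure_missEvent_le P hα hc hδ
            (hsched (firstBags S n)).2.1 (hsched (firstBags S n)).2.2)
          rintro ω ⟨n', hn', hω⟩
          have : n' = n := by
            rcases lt_trichotomy n' n with hlt | heq | hlt
            · exact absurd hn'.1 (hn.2 _ hlt)
            · exact heq
            · exact absurd hn.1 (hn'.2 _ hlt)
          rwa [this] at hω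
        · have : Prod.mk S ⁻¹' badEvent P = ∅ := by
            ext ω
            simp only [Set.mem_preimage, Set.mem_empty_iff_false, iff_false]
            rintro ⟨n, hn, -⟩
            exact h ⟨n, hn⟩
          rw [this, measure_empty]
          exact zero_le
    _ = _ := by simp

theorem output_eq_some {P : Params G α} {ω : Sample G α P.c} {T : Set (V × ℝ)}
    (h : output P ω = some T) : ∃ n, StopsAt P ω.1 n ∧ ∃ i, 1 ≤ i ∧
      StopTopk P (firstBags ω.1 n) ω.2.1 ω.2.2 i ∧
        T = topTilde P (firstBags ω.1 n) ω.2.1 ω.2.2 i := by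
  classical
  unfold output at h
  dsimp only at h
  split_ifs at h with h₁ h₂
  refine ⟨Nat.find h₁, ⟨Nat.find_spec h₁, fun k hk => Nat.find_min h₁ hk⟩, ?_⟩
  obtain ⟨hi, hs⟩ := Nat.find_spec h₂
  exact ⟨_, hi, hs, (Option.some.inj h).symm⟩

theorem isRelativeApprox_output {P : Params G α} (hk : 1 ≤ P.k) (hkn : P.k ≤ Fintype.card V)
    (hη : P.η ∈ Set.Ioo (0 : ℝ) 1) (v : Fin (Fintype.card V) ≃ V)
    (hv : Antitone fun i => betweenness G (v i)) {ω : Sample G α P.c} (hω : ω ∉ badEvent P)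
    {T : Set (V × ℝ)} (h : output P ω = some T) :
    IsRelativeApprox (betweenness G) v P.k hk hkn P.η T := by
  obtain ⟨n, hn, i, hi, hterm, rfl⟩ := output_eq_some h
  refine isRelativeApprox_topTilde hk hkn hη v hv (fun u => ?_) hterm
  by_contra! hlt
  exact hω ⟨n, hn, i, hi, u, hlt⟩

end Deviation

/-! ### Strong laws of large numbers -/

section StrongLaw

open ProbabilityTheory

/-- Pairwise independence is enough for the strong law, so only the laws of single terms and of
pairs enter. -/
theorem ae_tendsto_average {Ω Y : Type*} [MeasurableSpace Ω] {μ : Measure Ω}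
    [IsProbabilityMeasure μ] [Finite Y] [MeasurableSpace Y] [DiscreteMeasurableSpace Y]
    {ν : Measure Y} {W : ℕ → Ω → Y} (hW : ∀ i, Measurable (W i)) (hmap : ∀ i, μ.map (W i) = ν)
    (hind : ∀ i j, i ≠ j → μ.map (fun ω => (W i ω, W j ω)) = ν.prod ν) (g : Y → ℝ) :
    ∀ᵐ ω ∂μ, Tendsto (fun m : ℕ => 1 / (m : ℝ) * ∑ i ∈ Finset.range m, g (W i ω)) atTop
      (𝓝 (∫ y, g y ∂ν)) := by
  have hν : IsProbabilityMeasure ν := by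
    rw [← hmap 0]; exact Measure.isProbabilityMeasure_map (hW 0).aemeasurable
  have hg : Measurable g := Measurable.of_discrete
  have hint : Integrable (fun ω => g (W 0 ω)) μ := by
    have : Integrable g (μ.map (W 0)) := by rw [hmap]; exact Integrable.of_finite
    exact this.comp_measurable (hW 0)
  have h := strong_law_ae_real (μ := μ) (fun i ω => g (W i ω)) hint
    (fun i j hij => ((indepFun_iff_map_prod_eq_prod_map_map (hW i).aemeasurable
      (hW j).aemeasurable).2 (by rw [hind i j hij, hmap, hmap])).comp hg hg)
    (fun i => ⟨(hg.comp (hW i)).aemeasurable, (hg.comp (hW 0)).aemeasurable, by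
      rw [← Function.comp_def, ← Function.comp_def, ← Measure.map_map hg (hW i),
        ← Measure.map_map hg (hW 0), hmap, hmap]⟩)
  have e : ∫ ω, g (W 0 ω) ∂μ = ∫ y, g y ∂ν := by
    rw [← hmap 0, integral_map (hW 0).aemeasurable hg.aestronglyMeasurable]
  rw [e] at h
  filter_upwards [h] with ω hω
  simpa only [one_div_mul_eq_div] using hω

variable {A B : Type*} [MeasurableSpace A] [MeasurableSpace B] (μ : Measure A)
  [IsProbabilityMeasure μ] (ν : Measure B) [IsProbabilityMeasure ν]

theorem map_prod_infinitePi_eval (i : ℕ) :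
    ((Measure.infinitePi fun _ : ℕ => μ).prod (Measure.infinitePi fun _ : ℕ => ν)).map
      (fun ω => (ω.1 i, ω.2 i)) = μ.prod ν := by
  have h := Measure.map_prod_map (Measure.infinitePi fun _ : ℕ => μ)
    (Measure.infinitePi fun _ : ℕ => ν) (measurable_pi_apply i) (measurable_pi_apply i)
  rw [Measure.infinitePi_map_eval (fun _ : ℕ => μ) i,
    Measure.infinitePi_map_eval (fun _ : ℕ => ν) i] at h
  exact h.symm

theorem map_prod_infinitePi_eval_prod [Finite A] [DiscreteMeasurableSpace A] [Finite B]
    [DiscreteMeasurableSpace B] {i j : ℕ} (hij : i ≠ j) :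
    ((Measure.infinitePi fun _ : ℕ => μ).prod (Measure.infinitePi fun _ : ℕ => ν)).map
      (fun ω => ((ω.1 i, ω.2 i), (ω.1 j, ω.2 j))) = (μ.prod ν).prod (μ.prod ν) := by
  have h := Measure.map_prod_map (Measure.infinitePi fun _ : ℕ => μ)
    (Measure.infinitePi fun _ : ℕ => ν) (f := fun ω => (ω i, ω j)) (g := fun ω => (ω i, ω j))
    (by fun_prop) (by fun_prop)
  rw [Measure.infinitePi_map_eval_prod hij, Measure.infinitePi_map_eval_prod hij] at h
  have e : (fun ω : (ℕ → A) × (ℕ → B) => ((ω.1 i, ω.2 i), (ω.1 j, ω.2 j))) =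
      (fun z : (A × A) × (B × B) => ((z.1.1, z.2.1), (z.1.2, z.2.2))) ∘
        Prod.map (fun ω => (ω i, ω j)) (fun ω => (ω i, ω j)) := rfl
  rw [e, ← Measure.map_map (by fun_prop) (by fun_prop), ← h]
  refine Measure.ext_of_singleton fun ⟨⟨a, b⟩, ⟨a', b'⟩⟩ => ?_
  rw [Measure.map_apply (by fun_prop) (measurableSet_singleton _)]
  have e2 : (fun z : (A × A) × (B × B) => ((z.1.1, z.2.1), (z.1.2, z.2.2))) ⁻¹'
      {((a, b), (a', b'))} = ({a} ×ˢ {a'}) ×ˢ ({b} ×ˢ {b'}) := by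
    ext ⟨⟨x, x'⟩, ⟨y, y'⟩⟩
    simp only [Set.mem_preimage, Set.mem_singleton_iff, Prod.mk.injEq, Set.mem_prod]
    tauto
  rw [e2, ← Set.singleton_prod_singleton, ← Set.singleton_prod_singleton,
    ← Set.singleton_prod_singleton]
  simp only [Measure.prod_prod]
  ring

end StrongLaw

/-! ### Almost sure limits of the estimates and of the signed averages -/

section Convergence

variable {V : Type*} [Fintype V] [Nontrivial V] {G : Digraph V} {α : ℝ}

theorem integral_bagFrac (hα : 1 ≤ α) (u : V) :
    ∫ τ, bagFrac u τ ∂(bagPMF G α).toMeasure = betweenness G u := by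
  rw [PMF.integral_eq_sum, ← sum_weight_mul_bagFrac hα]
  rfl

theorem ae_tendsto_estimate (hα : 1 ≤ α) :
    ∀ᵐ S ∂(Measure.infinitePi fun _ : ℕ => (bagPMF G α).toMeasure),
      ∀ u, Tendsto (fun m => estimate S m u) atTop (𝓝 (betweenness G u)) := by
  rw [ae_all_iff]
  intro u
  have h := ae_tendsto_average (μ := Measure.infinitePi fun _ : ℕ => (bagPMF G α).toMeasure)
    (W := fun i S => S i) (fun i => measurable_pi_apply i)
    (fun i => Measure.infinitePi_map_eval (fun _ : ℕ => (bagPMF G α).toMeasure) i)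
    (fun i j hij => Measure.infinitePi_map_eval_prod
      (P := fun _ : ℕ => (bagPMF G α).toMeasure) hij) (bagFrac u)
  rwa [integral_bagFrac hα] at h

theorem integral_sgn (c : ℕ) (x : Fin c) :
    ∫ y, sgn (y x) ∂(PMF.uniformOfFintype (Fin c → Bool)).toMeasure = 0 := by
  rw [PMF.integral_eq_sum]
  change ∑ y, weight (PMF.uniformOfFintype (Fin c → Bool)) y * sgn (y x) = 0
  rw [weight_uniform_signs]
  change pexp signWeight c (fun y => sgn (y x)) = 0
  rw [pexp_eval signWeight_mem]
  simp [signWeight, sgn]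

theorem ae_tendsto_signed (G : Digraph V) (α : ℝ) (c : ℕ) :
    ∀ᵐ ω ∂(secondLaw G α c), ∀ (u : V) (x : Fin c), Tendsto (fun m : ℕ =>
      1 / (m : ℝ) * ∑ i ∈ Finset.range m, sgn (ω.2 i x) * bagFrac u (ω.1 i)) atTop (𝓝 0) := by
  simp_rw [ae_all_iff]
  intro u x
  have h := ae_tendsto_average (μ := secondLaw G α c) (W := fun i ω => (ω.1 i, ω.2 i))
    (fun i => by fun_prop) (fun i => map_prod_infinitePi_eval _ _ i)
    (fun i j hij => map_prod_infinitePi_eval_prod _ _ hij)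
    (fun y => sgn (y.2 x) * bagFrac u y.1)
  -- Signs are centered and independent of the bags.
  have e : ∫ y, sgn (y.2 x) * bagFrac u y.1 ∂((bagPMF G α).toMeasure.prod
      (PMF.uniformOfFintype (Fin c → Bool)).toMeasure) = 0 := by
    have := integral_prod_mul (μ := (bagPMF G α).toMeasure)
      (ν := (PMF.uniformOfFintype (Fin c → Bool)).toMeasure) (fun τ => bagFrac u τ)
      (fun y => sgn (y x))
    rw [integral_sgn, mul_zero] at this
    rw [← this]
    exact integral_congr_ae (ae_of_all _ fun y => mul_comm _ _)
  rwa [e] at h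

end Convergence

/-! ### Termination -/

section Termination

variable {V : Type*} [Fintype V] {G : Digraph V} {α : ℝ}

open Classical in
theorem sum_bagFrac_le_countP (S : ℕ → Bag G α) (u : V) (n : ℕ) :
    ∑ i ∈ Finset.range n, bagFrac u (S i) ≤
      ((firstBags S n).countP fun τ => decide (Observed u τ) : ℕ) := by
  induction n with
  | zero => simp [firstBags]
  | succ n ih =>
    have e : firstBags S (n + 1) = firstBags S n ++ [S n] := by
      simp [firstBags, List.range_succ]
    rw [Finset.sum_range_succ, e, List.countP_append, Nat.cast_add]
    refine add_le_add ih ?_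
    by_cases h : Observed u (S n)
    · simpa [h] using (bagFrac_mem_Icc u (S n)).2
    · simp [h, bagFrac_eq_zero h]

/-- The number of bags in which a node is observed is at least the sum of its `f_v`, which diverges
when the averages have a positive limit. -/
theorem exists_stopFirst (P : Params G α) (hkn : P.k ≤ Fintype.card V)
    (v : Fin (Fintype.card V) ≃ V) {b : V → ℝ}
    (hb : ∀ i : Fin (Fintype.card V), i.1 < P.k → 0 < b (v i)) {S : ℕ → Bag G α}
    (hS : ∀ u, Tendsto (fun m => estimate S m u) atTop (𝓝 (b u))) :
    ∃ n, StopFirst P (firstBags S n) := by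
  classical
  have hsum (i : Fin (Fintype.card V)) (hi : i.1 < P.k) :
      Tendsto (fun m : ℕ => ∑ l ∈ Finset.range m, bagFrac (v i) (S l)) atTop atTop := by
    have h := Tendsto.atTop_mul_pos (hb i hi) (tendsto_natCast_atTop_atTop (R := ℝ)) (hS (v i))
    refine h.congr' ?_
    filter_upwards [eventually_ge_atTop 1] with m hm
    have hm0 : (m : ℝ) ≠ 0 := by positivity
    rw [estimate, ← mul_assoc, mul_one_div_cancel hm0, one_mul]
  have hev : ∀ᶠ m : ℕ in atTop, ∀ i : Fin (Fintype.card V), i.1 < P.k →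
      (P.r : ℝ) ≤ ∑ l ∈ Finset.range m, bagFrac (v i) (S l) := by
    rw [eventually_all]
    intro i
    by_cases hi : i.1 < P.k
    · filter_upwards [(hsum i hi).eventually_ge_atTop (P.r : ℝ)] with m hm _ using hm
    · exact Eventually.of_forall fun m h => absurd h hi
  obtain ⟨n, hn⟩ := hev.exists
  refine ⟨n, ?_⟩
  unfold StopFirst
  calc P.k = ((Finset.univ.filter fun i : Fin (Fintype.card V) => i.1 < P.k).map
        v.toEmbedding).card := by
        rw [Finset.card_map, Fin.card_filter_val_lt, min_eq_right hkn]
    _ ≤ _ := by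
        refine Finset.card_le_card fun u hu => ?_
        simp only [Finset.mem_map, Finset.mem_filter, Finset.mem_univ, true_and] at hu ⊢
        obtain ⟨i, hi, rfl⟩ := hu
        have := (hn i hi).trans (sum_bagFrac_le_countP S (v i) n)
        exact_mod_cast this

theorem abs_iSup_le_sum {ι : Type*} [Fintype ι] (g : ι → ℝ) : |⨆ a, g a| ≤ ∑ a, |g a| := by
  rcases isEmpty_or_nonempty ι with h | h
  · simp
  · obtain ⟨a, ha⟩ := exists_eq_ciSup_of_finite (f := g)
    rw [← ha]
    exact Finset.single_le_sum (f := fun a => |g a|) (fun _ _ => abs_nonneg _) (Finset.mem_univ a)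

theorem tendsto_mcera {c t : ℕ} {S : ℕ → Bag G α} {σ : ℕ → Fin c → Bool}
    (h : ∀ (u : V) (x : Fin c), Tendsto (fun m : ℕ =>
      1 / (m : ℝ) * ∑ i ∈ Finset.range m, sgn (σ i x) * bagFrac u (S i)) atTop (𝓝 0))
    (lab : V → Fin t) (j : Fin t) : Tendsto (fun m => mcera S σ m lab j) atTop (𝓝 0) := by
  classical
  have hx (x : Fin c) : Tendsto (fun m : ℕ => ⨆ v : {v : V // lab v = j},
      1 / (m : ℝ) * ∑ i ∈ Finset.range m, sgn (σ i x) * bagFrac v.1 (S i)) atTop (𝓝 0) := by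
    refine squeeze_zero_norm (fun m => abs_iSup_le_sum _) ?_
    have := tendsto_finsetSum (Finset.univ : Finset {v : V // lab v = j})
      fun v _ => (h v.1 x).abs
    simpa using this
  have := (tendsto_finsetSum Finset.univ fun x _ => hx x).const_mul (1 / (c : ℝ))
  simpa [mcera] using this

/-- The wimpy variance, and hence `varBound`, need not vanish; they occur only multiplied by `L /
m`, so boundedness suffices. -/
theorem tendsto_epsBound {mc w L : ℕ → ℝ} {m : ℕ → ℕ} (c : ℕ) (hmc : Tendsto mc atTop (𝓝 0))
    (hw : ∀ i, w i ∈ Set.Icc (0 : ℝ) 1) (hL : Tendsto (fun i => L i / m i) atTop (𝓝 0)) :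
    Tendsto (fun i => epsBound (mc i) (w i) (varBound (w i) (L i) (m i)) (L i) c (m i)) atTop
      (𝓝 0) := by
  have hwl : Tendsto (fun i => w i * (L i / m i)) atTop (𝓝 0) := by
    refine squeeze_zero_norm (fun i => ?_) (tendsto_norm_zero.comp hL)
    rw [norm_mul, Real.norm_of_nonneg (hw i).1]
    exact mul_le_of_le_one_left (norm_nonneg _) (hw i).2
  set R' : ℕ → ℝ := fun i => mc i + √(4 * w i * L i / (c * m i)) with hR'
  have h1 : Tendsto R' atTop (𝓝 0) := by
    have := hmc.add ((hwl.const_mul (4 / (c : ℝ))).sqrt)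
    simp only [mul_zero, Real.sqrt_zero, add_zero] at this
    refine this.congr fun i => ?_
    rw [hR']
    congr 2
    ring
  set R : ℕ → ℝ := fun i => R' i + L i / m i + √((L i / m i) ^ 2 + 2 * L i * R' i / m i) with hR
  have h2 : Tendsto R atTop (𝓝 0) := by
    have := (h1.add hL).add (((hL.pow 2).add ((hL.mul h1).const_mul 2)).sqrt)
    simp only [mul_zero, add_zero, ne_eq, OfNat.ofNat_ne_zero, not_false_eq_true, zero_pow,
      Real.sqrt_zero] at this
    refine this.congr fun i => ?_
    simp only [hR]
    congr 3
    ring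
  have h3 : Tendsto (fun i => (L i / m i) * varBound (w i) (L i) (m i)) atTop (𝓝 0) := by
    have := (hwl.add (hL.pow 2)).add (hL.mul (((hL.pow 2).add (hwl.const_mul 2)).sqrt))
    simp only [mul_zero, add_zero, ne_eq, OfNat.ofNat_ne_zero, not_false_eq_true, zero_pow,
      Real.sqrt_zero] at this
    refine this.congr fun i => ?_
    have e : 2 * w i * L i / m i = 2 * (w i * (L i / m i)) := by ring
    rw [varBound, e]
    ring
  have h4 := ((h2.const_mul 2).add
    (((h3.add ((hL.mul h2).const_mul 4)).const_mul 2).sqrt)).add (hL.div_const 3)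
  simp only [mul_zero, add_zero, Real.sqrt_zero, zero_div] at h4
  refine h4.congr fun i => ?_
  have e1 : 2 * (L i / m i * varBound (w i) (L i) (m i) + 4 * (L i / m i * R i)) =
      2 * L i * (varBound (w i) (L i) (m i) + 4 * R i) / m i := by ring
  have e2 : L i / m i / 3 = L i / (3 * m i) := by ring
  rw [e1, e2]
  rfl

theorem wimpyVar_mem_Icc {t : ℕ} (S : ℕ → Bag G α) (m : ℕ) (lab : V → Fin t) (j : Fin t) :
    wimpyVar S m lab j ∈ Set.Icc (0 : ℝ) 1 := by
  refine ⟨Real.iSup_nonneg fun u => mul_nonneg (by positivity)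
    (Finset.sum_nonneg fun i _ => sq_nonneg _), Real.iSup_le (fun u => ?_) zero_le_one⟩
  rw [one_div_mul_eq_div]
  refine div_le_one_of_le₀ ?_ (Nat.cast_nonneg _)
  calc _ ≤ ∑ _i ∈ Finset.range m, (1 : ℝ) := Finset.sum_le_sum fun i _ =>
        pow_le_one₀ (bagFrac_mem_Icc u.1 _).1 (bagFrac_mem_Icc u.1 _).2
    _ = m := by simp

theorem tendsto_sched {s : ℕ → ℕ} (h1 : 1 ≤ s 1) (hmono : Monotone s)
    (hs : Tendsto (fun i : ℕ => (i : ℝ) / (s i : ℝ)) atTop (𝓝 0)) : Tendsto s atTop atTop := by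
  refine tendsto_atTop_mono' _ ?_ tendsto_id
  filter_upwards [hs.eventually_lt_const zero_lt_one, eventually_ge_atTop 1] with i hi hi1
  -- A quotient below one says nothing if `s i = 0`, where division returns `0`.
  have : 0 < s i := h1.trans (hmono hi1)
  rw [div_lt_one (by exact_mod_cast this)] at hi
  exact_mod_cast hi.le

variable (P : Params G α) {S' : List (Bag G α)} {S : ℕ → Bag G α} {σ : ℕ → Fin P.c → Bool}

theorem tendsto_width (hδ : 0 < P.δ) (h1 : 1 ≤ P.sched S' 1) (hmono : Monotone (P.sched S'))
    (hs : Tendsto (fun i : ℕ => (i : ℝ) / (P.sched S' i : ℝ)) atTop (𝓝 0))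
    (hσ : ∀ (u : V) (x : Fin P.c), Tendsto (fun m : ℕ =>
      1 / (m : ℝ) * ∑ i ∈ Finset.range m, sgn (σ i x) * bagFrac u (S i)) atTop (𝓝 0)) (u : V) :
    Tendsto (fun i => width P S' S σ i u) atTop (𝓝 0) := by
  have hm := tendsto_sched h1 hmono hs
  have ht : (0 : ℝ) < (P.peel S').1 := by
    exact_mod_cast Nat.zero_lt_of_lt ((P.peel S').2 u).2
  refine tendsto_epsBound P.c ((tendsto_mcera hσ _ _).comp hm) (fun i => wimpyVar_mem_Icc _ _ _ _) ?_
  have hinv : Tendsto (fun i => (P.sched S' i : ℝ)⁻¹) atTop (𝓝 0) :=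
    tendsto_inv_atTop_zero.comp (tendsto_natCast_atTop_atTop.comp hm)
  -- Here `L / m` is split into a constant over `m_i` and `log 2` times `i / m_i`; the second term
  -- is why the schedule must outgrow `i`.
  have h := (hinv.const_mul (Real.log (5 * (P.peel S').1 / P.δ))).add (hs.const_mul (Real.log 2))
  simp only [mul_zero, add_zero] at h
  refine h.congr fun i => ?_
  have e : 5 * ((P.peel S').1 : ℝ) * 2 ^ i / P.δ = 5 * (P.peel S').1 / P.δ * 2 ^ i := by ring
  rw [e, Real.log_mul (by positivity) (by positivity), Real.log_pow]
  ring

theorem exists_stopTopk (hk : 1 ≤ P.k) (hkn : P.k ≤ Fintype.card V)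
    (hη : P.η ∈ Set.Ioo (0 : ℝ) 1) (v : Fin (Fintype.card V) ≃ V) {b : V → ℝ} {β : ℝ} (hβ : 0 < β)
    (hb : ∀ i : Fin (Fintype.card V), i.1 < P.k → β ≤ b (v i))
    (hest : ∀ u, Tendsto (fun i => bTilde P S' S i u) atTop (𝓝 (b u)))
    (hwidth : ∀ u, Tendsto (fun i => width P S' S σ i u) atTop (𝓝 0)) :
    ∃ i, 1 ≤ i ∧ StopTopk P S' S σ i := by
  obtain ⟨hη0, hη1⟩ := hη
  -- With estimates and widths within `ε`, selection gives an estimate of at least `β - 3ε ≥ 7β /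
  -- 10`. Both stopping inequalities then hold, since `(1 + η) ε ≤ 2ε` is below `η` times that
  -- estimate.
  set ε := β * P.η / 10 with hε
  have hε0 : 0 < ε := by positivity
  have hβη : β * P.η ≤ β := by nlinarith
  have hev : ∀ᶠ i in atTop, ∀ u, |bTilde P S' S i u - b u| < ε ∧ |width P S' S σ i u| < ε := by
    rw [eventually_all]
    intro u
    have h1 := (tendsto_order.1 (tendsto_iff_norm_sub_tendsto_zero.1 (hest u))).2 ε hε0
    have h2 := (tendsto_order.1 (tendsto_iff_norm_sub_tendsto_zero.1 (hwidth u))).2 ε hε0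
    filter_upwards [h1, h2] with i hi1 hi2
    refine ⟨hi1, ?_⟩
    rw [sub_zero] at hi2
    exact hi2
  obtain ⟨i, hi, hi1⟩ := (hev.and (eventually_ge_atTop 1)).exists
  refine ⟨i, hi1, fun u hu => ?_⟩
  have hkth : β - 2 * ε ≤ kthLargest (lower P S' S σ i) P.k := by
    refine le_kthLargest_of_forall v hk hkn fun j hj => ?_
    have h1 := abs_lt.1 (hi (v j)).1
    have h2 := abs_lt.1 (hi (v j)).2
    have := hb j hj
    unfold lower
    linarith
  have hw := (abs_lt.1 (hi u).2).2
  have hu' : kthLargest (lower P S' S σ i) P.k ≤ bTilde P S' S i u + width P S' S σ i u := hu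
  have hbt : 7 / 10 * β ≤ bTilde P S' S i u := by linarith
  have hbη := mul_le_mul_of_nonneg_left hbt hη0.le
  unfold lower upper
  constructor
  · rw [div_le_iff₀ (by linarith)]
    nlinarith
  · rw [le_div_iff₀ (by linarith)]
    nlinarith

theorem exists_output {ω : Sample G α P.c} (h₁ : ∃ n, StopFirst P (firstBags ω.1 n))
    (h₂ : ∀ S', ∃ i, 1 ≤ i ∧ StopTopk P S' ω.2.1 ω.2.2 i) : ∃ T, output P ω = some T := by
  classical
  unfold output
  rw [dif_pos h₁]
  dsimp only
  rw [dif_pos (h₂ _)]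
  exact ⟨_, rfl⟩

theorem ae_exists_output [Nontrivial V] (hα : 1 ≤ α) (hk : 1 ≤ P.k) (hkn : P.k ≤ Fintype.card V)
    (hη : P.η ∈ Set.Ioo (0 : ℝ) 1) (hδ : 0 < P.δ)
    (hsched : ∀ S', P.sched S' 0 = 0 ∧ 1 ≤ P.sched S' 1 ∧ Monotone (P.sched S'))
    (hs : ∀ S', Tendsto (fun i : ℕ => (i : ℝ) / (P.sched S' i : ℝ)) atTop (𝓝 0))
    (v : Fin (Fintype.card V) ≃ V) {β : ℝ} (hβ : 0 < β)
    (hb : ∀ i : Fin (Fintype.card V), i.1 < P.k → β ≤ betweenness G (v i)) :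
    ∀ᵐ ω ∂(sampleLaw G α P.c), ∃ T, output P ω = some T := by
  have hA := ae_tendsto_estimate (G := G) hα
  have h1 : ∀ᵐ ω ∂(sampleLaw G α P.c), ∀ u, Tendsto (fun m => estimate ω.1 m u) atTop
      (𝓝 (betweenness G u)) := Measure.quasiMeasurePreserving_fst.ae hA
  have h2 : ∀ᵐ ω ∂(sampleLaw G α P.c), ∀ u, Tendsto (fun m => estimate ω.2.1 m u) atTop
      (𝓝 (betweenness G u)) :=
    Measure.quasiMeasurePreserving_snd.ae (Measure.quasiMeasurePreserving_fst.ae hA)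
  have h3 : ∀ᵐ ω ∂(sampleLaw G α P.c), ∀ (u : V) (x : Fin P.c), Tendsto (fun m : ℕ =>
      1 / (m : ℝ) * ∑ i ∈ Finset.range m, sgn (ω.2.2 i x) * bagFrac u (ω.2.1 i)) atTop (𝓝 0) :=
    Measure.quasiMeasurePreserving_snd.ae (ae_tendsto_signed G α P.c)
  filter_upwards [h1, h2, h3] with ω hω1 hω2 hω3
  refine exists_output P (exists_stopFirst P hkn v (fun i hi => hβ.trans_le (hb i hi)) hω1)
    fun S' => exists_stopTopk P hk hkn hη v hβ hb (fun u => ?_) fun u => ?_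
  · exact (hω2 u).comp (tendsto_sched (hsched S').2.1 (hsched S').2.2 (hs S'))
  · exact tendsto_width P hδ (hsched S').2.1 (hsched S').2.2 (hs S') hω3 u

end Termination

end Silvan

end

/-! ### The main theorem -/

theorem mainTheorem8 {V : Type*} [Fintype V] [Nontrivial V] (G : Digraph V)
    (α : ℝ) (hα : 1 ≤ α) (P : Silvan.Params G α)
    (hc : 1 ≤ P.c) (hk : 1 ≤ P.k) (hkn : P.k ≤ Fintype.card V) (hr : 1 ≤ P.r)
    (hη : P.η ∈ Set.Ioo (0 : ℝ) 1) (hδ : P.δ ∈ Set.Ioo (0 : ℝ) 1)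
    (hsched : ∀ S', P.sched S' 0 = 0 ∧ 1 ≤ P.sched S' 1 ∧ Monotone (P.sched S'))
    (v : Fin (Fintype.card V) ≃ V) (hv : Antitone fun i => Silvan.betweenness G (v i)) :
    1 - P.δ ≤ (Silvan.sampleLaw G α P.c).real
        {ω | ∀ T, Silvan.output P ω = some T →
          Silvan.IsRelativeApprox (Silvan.betweenness G) v P.k hk hkn P.η T} ∧
    (0 < Silvan.betweenness G (v ⟨P.k - 1, by omega⟩) →
      (∀ S', Tendsto (fun i : ℕ => (i : ℝ) / (P.sched S' i : ℝ)) atTop (𝓝 0)) →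
      (∀ᵐ ω ∂(Silvan.sampleLaw G α P.c), ∃ T, Silvan.output P ω = some T) ∧
      1 - P.δ ≤ (Silvan.sampleLaw G α P.c).real
        {ω | ∃ T, Silvan.output P ω = some T ∧
          Silvan.IsRelativeApprox (Silvan.betweenness G) v P.k hk hkn P.η T}) := by
  have hgood : 1 - P.δ ≤ (Silvan.sampleLaw G α P.c).real (Silvan.badEvent P)ᶜ := by
    rw [probReal_compl_eq_one_sub (Silvan.measurableSet_badEvent P)]
    have := ENNReal.toReal_mono ENNReal.ofReal_ne_top (Silvan.measure_badEvent_le P hα hc hδ hsched)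
    rw [ENNReal.toReal_ofReal hδ.1.le] at this
    exact sub_le_sub_left this 1
  have happrox {ω} (hω : ω ∈ (Silvan.badEvent P)ᶜ) {T} (hT : Silvan.output P ω = some T) :=
    Silvan.isRelativeApprox_output hk hkn hη v hv hω hT
  -- Only `badEvent` has to be measurable: the success event contains its complement, and
  -- monotonicity holds for arbitrary sets.
  refine ⟨hgood.trans (measureReal_mono fun ω hω T hT => happrox hω hT), fun hpos hs => ?_⟩
  have hhalt := Silvan.ae_exists_output P hα hk hkn hη hδ.1 hsched hs v hpos fun i hi =>
    hv (a := i) (b := ⟨P.k - 1, by omega⟩) (Fin.mk_le_mk.2 (by omega))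
  refine ⟨hhalt, hgood.trans ?_⟩
  refine ENNReal.toReal_mono (measure_ne_top _ _) (measure_mono_ae ?_)
  filter_upwards [hhalt] with ω ⟨T, hT⟩ hω
  exact ⟨T, hT, happrox hω hT⟩
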